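/- Fix $n\ge 0$ and let $S_n$ be the symmetric group on $[n]=\{1,\dots,n\}$, with $\ell(w)$ the number of inversions of $w\in S_n$. Let $S_n[\mathbf q]=\{\mathbf q^\alpha w : w\in S_n,\ \alpha\in\mathbb Z_{\ge0}^{n-1}\}$, where $\mathbf q^\alpha=q_1^{\alpha_1}\cdots q_{n-1}^{\alpha_{n-1}}$, put $\ell(\mathbf q^\alpha w)=\ell(w)+2\sum_i\alpha_i$, and for $i<j$ put $\mathbf q_{ij}=q_iq_{i+1}\cdots q_{j-1}$. Write $s_{ab}$ for the transposition of $a$ and $b$. For $k\in[n-1]$ the cover relation $\lessdot_k^{\mathbf q}$ of the quantum $k$-Bruhat order on $S_n[\mathbf q]$ is: $\mathbf q^\alpha w\lessdot_k^{\mathbf q} y$ if and only if there are positions $i\le k<j$ such that $y=\mathbf q^\alpha ws_{ij}$ or $y=\mathbf q^\alpha\mathbf q_{ij}ws_{ij}$, and $\ell(y)=\ell(\mathbf q^\alpha w)+1$. Let $\mathcal F_n^{\mathbf q}$ be the free monoid on the symbols $\mathbf v_{ab}$ with $a\ne b$ in $[n]$ (the operators), and adjoin a zero element $\mathbf 0$.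 The degree of an element of $\mathcal F_n^{\mathbf q}$ is the number of its operators. For each $k\in[n-1]$, the monoid $\mathcal F_n^{\mathbf q}\cup\{\mathbf 0\}$ acts from the left on $S_n[\mathbf q]\cup\{0\}$ (the rightmost operator acts first): $\mathbf 0$ sends everything to $0$, every operator fixes $0$, and for $u\in S_n$ $$\mathbf v_{ab}\bullet_k \mathbf q^\alpha u=\begin{cases}\mathbf q^\alpha s_{ab}u,& a<b\text{ and }u\lessdot_k^{\mathbf q}s_{ab}u,\\ \mathbf q^\alpha\mathbf q_{ij}s_{ab}u,& a>b,\ u(i)=a,\ u(j)=b,\ i<j\text{ and }u\lessdot_k^{\mathbf q}\mathbf q_{ij}s_{ab}u,\\ 0,&\text{otherwise.}\end{cases}$$ For $\mathbf v,\mathbf v'\in\mathcal F_n^{\mathbf q}\cup\{\mathbf 0\}$ write $\mathbf v\equiv\mathbf v'$ if $\mathbf v\bullet_k x=\mathbf v'\bullet_k x$ for all $x\in S_n[\mathbf q]$ and all $k\in[n-1]$. The degree of an equivalence is the larger of the degrees of its two sides, with $\mathbf 0$ counted as degree $0$. An equivalence $\mathbf v\equiv\mathbf v'$ is non-zero if $\mathbf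 v\not\equiv\mathbf 0$, and it is minimal if the pair $(\mathbf v,\mathbf v')$ does not belong to the congruence on the monoid $\mathcal F_n^{\mathbf q}\cup\{\mathbf 0\}$ generated by all equivalences of smaller degree. **Theorem.** Up to exchanging the two sides, the minimal non-zero equivalences of degree three are exactly the following, where in (i)--(vi) $a<b<c$ are arbitrary elements of $[n]$, and in (vii)--(xiv) $a<b<c<d$ are arbitrary elements of $[n]$: - (i) $\mathbf v_{cb}\mathbf v_{bc}\mathbf v_{ab}\equiv\mathbf v_{ab}\mathbf v_{ca}\mathbf v_{ac}$ - (ii) $\mathbf v_{ac}\mathbf v_{ca}\mathbf v_{bc}\equiv\mathbf v_{bc}\mathbf v_{ab}\mathbf v_{ba}$ - (iii) $\mathbf v_{ba}\mathbf v_{ab}\mathbf v_{ca}\equiv\mathbf v_{ca}\mathbf v_{bc}\mathbf v_{cb}$ - (iv) $\mathbf v_{ba}\mathbf v_{ab}\mathbf v_{bc}\equiv\mathbf v_{bc}\mathbf v_{ca}\mathbf v_{ac}$ - (v) $\mathbf v_{cb}\mathbf v_{bc}\mathbf v_{ca}\equiv\mathbf v_{ca}\mathbf v_{ab}\mathbf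 v_{ba}$ - (vi) $\mathbf v_{ac}\mathbf v_{ca}\mathbf v_{ab}\equiv\mathbf v_{ab}\mathbf v_{bc}\mathbf v_{cb}$ - (vii) $\mathbf v_{db}\mathbf v_{bc}\mathbf v_{ab}\equiv\mathbf v_{ab}\mathbf v_{da}\mathbf v_{ac}$ - (viii) $\mathbf v_{ac}\mathbf v_{cd}\mathbf v_{bc}\equiv\mathbf v_{bc}\mathbf v_{ab}\mathbf v_{bd}$ - (ix) $\mathbf v_{bd}\mathbf v_{da}\mathbf v_{cd}\equiv\mathbf v_{cd}\mathbf v_{bc}\mathbf v_{ca}$ - (x) $\mathbf v_{ca}\mathbf v_{ab}\mathbf v_{da}\equiv\mathbf v_{da}\mathbf v_{cd}\mathbf v_{db}$ - (xi) $\mathbf v_{ca}\mathbf v_{bc}\mathbf v_{cd}\equiv\mathbf v_{cd}\mathbf v_{da}\mathbf v_{bd}$ - (xii) $\mathbf v_{db}\mathbf v_{cd}\mathbf v_{da}\equiv\mathbf v_{da}\mathbf v_{ab}\mathbf v_{ca}$ - (xiii) $\mathbf v_{ac}\mathbf v_{da}\mathbf v_{ab}\equiv\mathbf v_{ab}\mathbf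 v_{bc}\mathbf v_{db}$ - (xiv) $\mathbf v_{bd}\mathbf v_{ab}\mathbf v_{bc}\equiv\mathbf v_{bc}\mathbf v_{cd}\mathbf v_{ac}$ -/

import Mathlib

namespace QuantumBruhat

/-- The set `S_n[q]`: the pair `(α, w)` stands for `q^α w`. Values, positions, the parameter `k` and
the indices of the variables `q_1, …, q_{n-1}` are all shifted down by one. -/
abbrev SnQ (n : ℕ) : Type := (Fin (n - 1) → ℕ) × Equiv.Perm (Fin n)

/-- The number of inversions of a permutation. -/
def invLength {n : ℕ} (w : Equiv.Perm (Fin n)) : ℕ :=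
  (Finset.univ.filter fun p : Fin n × Fin n => p.1 < p.2 ∧ w p.2 < w p.1).card

/-- `ℓ(q^α w) = ℓ(w) + 2 deg q^α`. -/
def qLength {n : ℕ} (x : SnQ n) : ℕ :=
  invLength x.2 + 2 * ∑ t, x.1 t

/-- The exponent vector of `q_{ij} = q_i q_{i+1} ⋯ q_{j-1}`. -/
def qExp {n : ℕ} (i j : Fin n) : Fin (n - 1) → ℕ :=
  fun t => if (i : ℕ) ≤ (t : ℕ) ∧ (t : ℕ) < (j : ℕ) then 1 else 0

/-- The cover relation of the quantum `k`-Bruhat order on `S_n[q]`, extended `q`-multiplicatively: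
`q^α w` is covered by `q^α w s_{ij}` (classical cover) or by `q^α q_{ij} w s_{ij}` (quantum cover),
for positions `i ≤ k < j`, whenever the length goes up by exactly one. -/
def QCover {n : ℕ} (k : Fin (n - 1)) (x y : SnQ n) : Prop :=
  ∃ i j : Fin n, (i : ℕ) ≤ (k : ℕ) ∧ (k : ℕ) < (j : ℕ) ∧
    (y = (x.1, x.2 * Equiv.swap i j) ∨ y = (x.1 + qExp i j, x.2 * Equiv.swap i j)) ∧
    qLength y = qLength x + 1

instance {n : ℕ} (k : Fin (n - 1)) (x y : SnQ n) : Decidable (QCover k x y) := by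
  unfold QCover
  infer_instance

/-- The operator symbols `v_{ab}` with `a ≠ b` in `[n]`. -/
abbrev Op (n : ℕ) : Type := {p : Fin n × Fin n // p.1 ≠ p.2}

/-- The free monoid `F_n^q` on the operator symbols; its elements are the compositions of operators. -/
abbrev Word (n : ℕ) : Type := FreeMonoid (Op n)

/-- The generator `v_{ab}`. -/
def v {n : ℕ} (a b : Fin n) (h : a ≠ b) : Word n := FreeMonoid.of ⟨(a, b), h⟩

/-- The action of a single operator `v_{ab}` on `S_n[q]`; `none` is the element `0` adjoined to
`S_n[q]`. In the quantum case `a > b`, the monomial `q_{ij}`, with `u(i) = a` and `u(j) = b`, is only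
available for `i < j`. -/
def opAct {n : ℕ} (k : Fin (n - 1)) (o : Op n) (x : SnQ n) : Option (SnQ n) :=
  let a := o.1.1
  let b := o.1.2
  let i := x.2.symm a
  let j := x.2.symm b
  if a < b ∧ QCover k x (x.1, Equiv.swap a b * x.2) then
    some (x.1, Equiv.swap a b * x.2)
  else if b < a ∧ i < j ∧ QCover k x (x.1 + qExp i j, Equiv.swap a b * x.2) then
    some (x.1 + qExp i j, Equiv.swap a b * x.2)
  else none

/-- The action of compositions on `S_n[q] ∪ {0}`. The product in `Function.End` is composition of
maps, so that the rightmost operator acts first, and every operator sends `0` to `0`. -/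
def wordAct {n : ℕ} (k : Fin (n - 1)) : Word n →* Function.End (Option (SnQ n)) :=
  FreeMonoid.lift fun o => ((fun x => x.bind (opAct k o)) : Option (SnQ n) → Option (SnQ n))

/-- The action of `F_n^q ∪ {𝟎}`; the zero operator sends everything to `0`. -/
def act {n : ℕ} (k : Fin (n - 1)) : WithZero (Word n) → Option (SnQ n) → Option (SnQ n)
  | none => fun _ => none
  | some w => wordAct k w

/-- Equivalence of elements of `F_n^q ∪ {𝟎}`: the same action on all of `S_n[q]` for all `k`. -/
def Equivalent {n : ℕ} (x y : WithZero (Word n)) : Prop :=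
  ∀ (k : Fin (n - 1)) (u : SnQ n), act k x (some u) = act k y (some u)

/-- The number of operators in an element of `F_n^q ∪ {𝟎}` (none for the zero operator). -/
def degree {n : ℕ} : WithZero (Word n) → ℕ
  | none => 0
  | some w => w.length

/-- The degree of an equivalence `x ≡ y`. -/
def equivDegree {n : ℕ} (x y : WithZero (Word n)) : ℕ := max (degree x) (degree y)

/-- All consequences of the equivalences of degree less than `r`: the congruence of the monoid
`F_n^q ∪ {𝟎}` that they generate. -/
def lowerCon (n r : ℕ) : Con (WithZero (Word n)) :=
  conGen fun x y => Equivalent x y ∧ equivDegree x y < r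

/-- An equivalence is minimal if it is not a consequence of equivalences of lower degree. -/
def IsMinimalEquiv {n : ℕ} (x y : WithZero (Word n)) : Prop :=
  Equivalent x y ∧ ¬ lowerCon n (equivDegree x y) x y

/-- The fourteen families of pairs of compositions of degree three. -/
inductive Listed {n : ℕ} : Word n → Word n → Prop
  | rel_i {a b c : Fin n} (ab : a < b) (bc : b < c) (ac : a < c) :
      Listed (v c b bc.ne' * v b c bc.ne * v a b ab.ne) (v a b ab.ne * v c a ac.ne' * v a c ac.ne)
  | rel_ii {a b c : Fin n} (ab : a < b) (bc : b < c) (ac : a < c) :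
      Listed (v a c ac.ne * v c a ac.ne' * v b c bc.ne) (v b c bc.ne * v a b ab.ne * v b a ab.ne')
  | rel_iii {a b c : Fin n} (ab : a < b) (bc : b < c) (ac : a < c) :
      Listed (v b a ab.ne' * v a b ab.ne * v c a ac.ne') (v c a ac.ne' * v b c bc.ne * v c b bc.ne')
  | rel_iv {a b c : Fin n} (ab : a < b) (bc : b < c) (ac : a < c) :
      Listed (v b a ab.ne' * v a b ab.ne * v b c bc.ne) (v b c bc.ne * v c a ac.ne' * v a c ac.ne)
  | rel_v {a b c : Fin n} (ab : a < b) (bc : b < c) (ac : a < c) :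
      Listed (v c b bc.ne' * v b c bc.ne * v c a ac.ne') (v c a ac.ne' * v a b ab.ne * v b a ab.ne')
  | rel_vi {a b c : Fin n} (ab : a < b) (bc : b < c) (ac : a < c) :
      Listed (v a c ac.ne * v c a ac.ne' * v a b ab.ne) (v a b ab.ne * v b c bc.ne * v c b bc.ne')
  | rel_vii {a b c d : Fin n} (ab : a < b) (bc : b < c) (ac : a < c) (ad : a < d) (bd : b < d)
      (cd : c < d) :
      Listed (v d b bd.ne' * v b c bc.ne * v a b ab.ne) (v a b ab.ne * v d a ad.ne' * v a c ac.ne)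
  | rel_viii {a b c d : Fin n} (ab : a < b) (bc : b < c) (ac : a < c) (ad : a < d) (bd : b < d)
      (cd : c < d) :
      Listed (v a c ac.ne * v c d cd.ne * v b c bc.ne) (v b c bc.ne * v a b ab.ne * v b d bd.ne)
  | rel_ix {a b c d : Fin n} (ab : a < b) (bc : b < c) (ac : a < c) (ad : a < d) (bd : b < d)
      (cd : c < d) :
      Listed (v b d bd.ne * v d a ad.ne' * v c d cd.ne) (v c d cd.ne * v b c bc.ne * v c a ac.ne')
  | rel_x {a b c d : Fin n} (ab : a < b) (bc : b < c) (ac : a < c) (ad : a < d) (bd : b < d)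
      (cd : c < d) :
      Listed (v c a ac.ne' * v a b ab.ne * v d a ad.ne') (v d a ad.ne' * v c d cd.ne * v d b bd.ne')
  | rel_xi {a b c d : Fin n} (ab : a < b) (bc : b < c) (ac : a < c) (ad : a < d) (bd : b < d)
      (cd : c < d) :
      Listed (v c a ac.ne' * v b c bc.ne * v c d cd.ne) (v c d cd.ne * v d a ad.ne' * v b d bd.ne)
  | rel_xii {a b c d : Fin n} (ab : a < b) (bc : b < c) (ac : a < c) (ad : a < d) (bd : b < d)
      (cd : c < d) :
      Listed (v d b bd.ne' * v c d cd.ne * v d a ad.ne') (v d a ad.ne' * v a b ab.ne * v c a ac.ne')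
  | rel_xiii {a b c d : Fin n} (ab : a < b) (bc : b < c) (ac : a < c) (ad : a < d) (bd : b < d)
      (cd : c < d) :
      Listed (v a c ac.ne * v d a ad.ne' * v a b ab.ne) (v a b ab.ne * v b c bc.ne * v d b bd.ne')
  | rel_xiv {a b c d : Fin n} (ab : a < b) (bc : b < c) (ac : a < c) (ad : a < d) (bd : b < d)
      (cd : c < d) :
      Listed (v b d bd.ne * v a b ab.ne * v b c bc.ne) (v b c bc.ne * v c d cd.ne * v a c ac.ne)

end QuantumBruhat

namespace QuantumBruhat

open Equiv

/-! Place the letters on a circle. Whether a step is classical or quantum, `v_{ab}` acts as non-zero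
exactly when `a` stands at a position at most `k`, `b` at one beyond `k`, and no letter of the open
cyclic interval from `a` up to `b` stands between them (`qCover_classical_iff`,
`qCover_quantum_iff`). In this form the action is invariant under rotating the letters, apart from
the monomial, and the fourteen families become two, `CyclicFamily.outer` and `CyclicFamily.inner`,
exchanged by reversing both positions and letters.

The relations hold because both sides ask for the same region of the position-letter plane to be
free of other letters, with the same condition on the named ones (`moves_outer`, `moves_inner`). The
monomials agree because all the position intervals involved contain the cut at `k`.

For completeness, lift each step to the line: the left position moves up from `a` to `b`, the right
one down from `b` to `a`, and a quantum step passes the end of the alphabet. The final permutation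
and monomial determine, for each position, its final letter and its net number of turns
(`sameMotion_of_run`). This motion is read off from the operators alone. Three operators involve at
most six letters and everything depends only on their relative order, so a finite check
(`motionCheck_eq_true`) shows that two admissible triples with the same motion differ by
commutations of disjoint operators or form a pair of one of the families.

For minimality, commutations come from degree two. Conversely, a lower equivalence applied inside a
member `x` of a family leaves the first or last operator in place, and the classification then
forces the result to be `x` itself (`eq_of_equivalent`). So the congruence generated by lower
equivalences relates `x` to nothing else (`lowerCon_le_syntacticCon`). -/

/-! ### Inversions and transpositions -/

/-- `x` lies strictly inside the cyclic interval running upwards from `a` to `b`. -/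
def Cyc (a x b : ℕ) : Prop := (a < x ∧ x < b) ∨ (b < a ∧ (a < x ∨ x < b))

instance (a x b : ℕ) : Decidable (Cyc a x b) := by
  unfold Cyc
  infer_instance

theorem sum_univ_eq_add_add_erase {ι : Type*} [Fintype ι] [DecidableEq ι] {i j : ι} (h : i ≠ j)
    (f : ι → ℕ) : ∑ t, f t = f i + (f j + ∑ t ∈ (Finset.univ.erase i).erase j, f t) := by
  rw [Finset.add_sum_erase _ _ (by simp [h.symm]), Finset.add_sum_erase _ _ (by simp)]

theorem invLength_eq_sum {n : ℕ} (w : Perm (Fin n)) :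
    invLength w = ∑ p, ∑ q, if p < q ∧ w q < w p then 1 else 0 := by
  rw [invLength, Finset.card_filter, Fintype.sum_prod_type]

/-- Multiplying by a transposition that creates an inversion. -/
theorem invLength_mul_swap {n : ℕ} (w : Perm (Fin n)) {i j : Fin n} (hij : i < j)
    (hw : w i < w j) :
    invLength (w * swap i j) = invLength w + 1 +
      2 * (Finset.univ.filter fun t => i < t ∧ t < j ∧ w i < w t ∧ w t < w j).card := by
  -- The double sum over pairs is split according to which entries lie in `{i, j}`.
  have key : ∀ g : Fin n → Fin n → ℕ, ∑ p, ∑ q, g p q =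
      g i i + g i j + g j i + g j j +
      ∑ t ∈ (Finset.univ.erase i).erase j, (g t i + g t j + g i t + g j t) +
      ∑ p ∈ (Finset.univ.erase i).erase j, ∑ q ∈ (Finset.univ.erase i).erase j, g p q := by
    intro g
    simp only [sum_univ_eq_add_add_erase hij.ne, Finset.sum_add_distrib]
    ring
  have hfil : (Finset.univ.filter fun t => i < t ∧ t < j ∧ w i < w t ∧ w t < w j).card =
      ∑ t ∈ (Finset.univ.erase i).erase j,
        if i < t ∧ t < j ∧ w i < w t ∧ w t < w j then 1 else 0 := by
    rw [Finset.card_filter, sum_univ_eq_add_add_erase hij.ne]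
    simp
  rw [invLength_eq_sum, invLength_eq_sum, key, key, hfil]
  have hrest : ∀ t ∈ (Finset.univ.erase i).erase j, (w * swap i j) t = w t := by
    intro t ht
    simp only [Finset.mem_erase, Finset.mem_univ, and_true] at ht
    simp [swap_apply_of_ne_of_ne ht.2 ht.1]
  have hi : (w * swap i j) i = w j := by simp
  have hj : (w * swap i j) j = w i := by simp
  have h1 : ∑ p ∈ (Finset.univ.erase i).erase j, ∑ q ∈ (Finset.univ.erase i).erase j,
      (if p < q ∧ (w * swap i j) q < (w * swap i j) p then 1 else 0) =
      ∑ p ∈ (Finset.univ.erase i).erase j, ∑ q ∈ (Finset.univ.erase i).erase j,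
      (if p < q ∧ w q < w p then 1 else 0) := by
    refine Finset.sum_congr rfl fun p hp => Finset.sum_congr rfl fun q hq => ?_
    rw [hrest p hp, hrest q hq]
  -- The pairs formed by `t` with `i` and `j` gain two inversions if `t` lies between `i` and `j`
  -- both in position and in value, and keep their number otherwise.
  have h2 : ∑ t ∈ (Finset.univ.erase i).erase j,
      ((if t < i ∧ (w * swap i j) i < (w * swap i j) t then 1 else 0) +
        (if t < j ∧ (w * swap i j) j < (w * swap i j) t then 1 else 0) +
        (if i < t ∧ (w * swap i j) t < (w * swap i j) i then 1 else 0) +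
        (if j < t ∧ (w * swap i j) t < (w * swap i j) j then 1 else 0)) =
      ∑ t ∈ (Finset.univ.erase i).erase j,
      ((if t < i ∧ w i < w t then 1 else 0) + (if t < j ∧ w j < w t then 1 else 0) +
        (if i < t ∧ w t < w i then 1 else 0) + (if j < t ∧ w t < w j then 1 else 0)) +
      2 * ∑ t ∈ (Finset.univ.erase i).erase j,
        if i < t ∧ t < j ∧ w i < w t ∧ w t < w j then 1 else 0 := by
    rw [Finset.mul_sum, ← Finset.sum_add_distrib]
    refine Finset.sum_congr rfl fun t ht => ?_
    rw [hrest t ht, hi, hj]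
    simp only [Finset.mem_erase, Finset.mem_univ, and_true] at ht
    have e1 : w t ≠ w i := fun h => ht.2 (w.injective h)
    have e2 : w t ≠ w j := fun h => ht.1 (w.injective h)
    obtain ⟨e3, e4⟩ := ht
    have e5 := hij.ne
    rcases lt_or_gt_of_ne e3 with a | a <;> rcases lt_or_gt_of_ne e4 with b | b <;>
    rcases lt_or_gt_of_ne e1 with c | c <;> rcases lt_or_gt_of_ne e2 with d | d <;>
    first
    | (exfalso; order)
    | simp [a, b, c, d, a.not_gt, b.not_gt, c.not_gt, d.not_gt]
  rw [h1, h2, hi, hj]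
  simp [hij, hij.not_gt, hw, hw.not_gt]
  ring

/-! ### Covers as conditions on cyclic intervals -/

/-- The condition for `v_{ab}` to act as non-zero on a permutation in which the letter `e` stands at
position `p e`. -/
def Moves {n : ℕ} (k : Fin (n - 1)) (p : Perm (Fin n)) (a b : Fin n) : Prop :=
  (p a : ℕ) ≤ k ∧ (k : ℕ) < p b ∧ ∀ e, p a < p e → p e < p b → ¬ Cyc a e b

/-- The exponent of the monomial picked up by `v_{ab}`. -/
def wrapExp {n : ℕ} (p : Perm (Fin n)) (a b : Fin n) : Fin (n - 1) → ℕ :=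
  if a < b then 0 else qExp (p a) (p b)

theorem sum_qExp {n : ℕ} {i j : Fin n} : ∑ t, qExp i j t = (j : ℕ) - i := by
  unfold qExp
  rw [Fin.sum_univ_eq_sum_range (fun t => if (i : ℕ) ≤ t ∧ t < (j : ℕ) then 1 else 0) (n - 1),
    Finset.sum_boole]
  have : (Finset.range (n - 1)).filter (fun t => (i : ℕ) ≤ t ∧ t < (j : ℕ)) = Finset.Ico ↑i ↑j := by
    ext t
    simp only [Finset.mem_filter, Finset.mem_range, Finset.mem_Ico]
    omega
  rw [this]
  simp

theorem qExp_apply_eq_one {n : ℕ} {i j : Fin n} {t : Fin (n - 1)} (h : (i : ℕ) ≤ t)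
    (h' : (t : ℕ) < j) : qExp i j t = 1 := by
  simp [qExp, h, h']

theorem swap_mul_eq {n : ℕ} (u : Perm (Fin n)) (a b : Fin n) :
    swap a b * u = u * swap (u.symm a) (u.symm b) := by
  rw [mul_swap_eq_swap_mul]
  simp

theorem swap_eq_swap_iff {n : ℕ} {i j i' j' : Fin n} (h : i ≠ j) (e : swap i j = swap i' j') :
    (i' = i ∧ j' = j) ∨ (i' = j ∧ j' = i) := by
  have h1 : swap i' j' i = j := by rw [← e]; simp
  have h2 : swap i' j' j = i := by rw [← e]; simp
  rw [swap_apply_def] at h1 h2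
  grind

theorem invLength_mul_swap_of_gt {n : ℕ} (w : Perm (Fin n)) {i j : Fin n} (hij : i < j)
    (hw : w j < w i) :
    invLength w = invLength (w * swap i j) + 1 +
      2 * (Finset.univ.filter fun t => i < t ∧ t < j ∧ w j < w t ∧ w t < w i).card := by
  have h := invLength_mul_swap (w * swap i j) hij (by simpa using hw)
  rw [mul_assoc, swap_mul_self, mul_one] at h
  rw [h]
  congr 3
  ext t
  simp only [Finset.mem_filter, Finset.mem_univ, true_and, Perm.mul_apply, swap_apply_left,
    swap_apply_right]
  constructor <;> rintro ⟨h1, h2, h3⟩ <;>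
    [rw [swap_apply_of_ne_of_ne h1.ne' h2.ne] at h3; rw [swap_apply_of_ne_of_ne h1.ne' h2.ne]] <;>
    exact ⟨h1, h2, h3⟩

/-- The length grows by one plus twice the number of letters lying between `a` and `b` in both
position and value, so a cover means that there are none. For `a < b` the cyclic interval is the
ordinary one. -/
theorem qCover_classical_iff {n : ℕ} {k : Fin (n - 1)} {α : Fin (n - 1) → ℕ} {u : Perm (Fin n)}
    {a b : Fin n} (h : a < b) :
    QCover k (α, u) (α, swap a b * u) ↔ Moves k u.symm a b := by
  set i := u.symm a with hi
  set j := u.symm b with hj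
  have ha : a = u i := by simp [hi]
  have hb : b = u j := by simp [hj]
  have hne : i ≠ j := fun e => h.ne (by rw [ha, hb, e])
  have key : i < j → ((invLength (u * swap i j) = invLength u + 1) ↔
      ∀ e, i < u.symm e → u.symm e < j → ¬ Cyc a e b) := by
    intro hij
    rw [invLength_mul_swap u hij (by rw [← ha, ← hb]; exact h)]
    have : ∀ m : ℕ, m + 1 + 2 * (Finset.univ.filter
        fun t => i < t ∧ t < j ∧ u i < u t ∧ u t < u j).card = m + 1 ↔
        (Finset.univ.filter fun t => i < t ∧ t < j ∧ u i < u t ∧ u t < u j) = ∅ := by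
      intro m
      rw [← Finset.card_eq_zero]
      omega
    rw [this, Finset.filter_eq_empty_iff]
    constructor
    · intro H e h1 h2
      have := H (Finset.mem_univ (u.symm e))
      rw [← ha, ← hb, apply_symm_apply] at this
      rw [Cyc]
      grind
    · intro H t _ ⟨h1, h2, h3, h4⟩
      have := H (u t) (by simpa using h1) (by simpa using h2)
      rw [Cyc] at this
      grind
  rw [swap_mul_eq, ← hi, ← hj]
  constructor
  · rintro ⟨i', j', hi', hj', hy | hy, hl⟩
    · have e := swap_eq_swap_iff hne (mul_left_cancel (Prod.ext_iff.1 hy).2)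
      simp only [qLength] at hl
      have hl : invLength (u * swap i j) = invLength u + 1 := by omega
      rcases e with ⟨rfl, rfl⟩ | ⟨rfl, rfl⟩
      · exact ⟨hi', hj', (key (by omega)).1 hl⟩
      -- Here the left position carries the larger letter, so the transposition would lower the
      -- length.
      · exfalso
        have := invLength_mul_swap_of_gt u (i := j) (j := i) (by omega)
          (by rw [← ha, ← hb]; exact h)
        rw [swap_comm] at hl
        omega
    -- The monomial of a quantum cover has exponent one at `k`, so it cannot leave `α` unchanged.
    · have := congrFun (Prod.ext_iff.1 hy).1 k
      simp [qExp_apply_eq_one hi' hj'] at this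
  · rintro ⟨h1, h2, h3⟩
    refine ⟨i, j, h1, h2, Or.inl rfl, ?_⟩
    have := (key (by omega)).2 h3
    simp only [qLength]
    omega

/-- The transposition lowers the length by one plus twice the size of `F`, and the monomial adds `2
* (j - i)`. The net gain is one exactly when `F` has `j - i - 1` elements, that is, fills the gap
between `i` and `j`: every letter in between lies strictly between `b` and `a`, which is the
complement of the wrapped interval from `a` to `b`. -/
theorem qCover_quantum_iff {n : ℕ} {k : Fin (n - 1)} {α : Fin (n - 1) → ℕ} {u : Perm (Fin n)}
    {a b : Fin n} (h : b < a) :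
    (u.symm a < u.symm b ∧
      QCover k (α, u) (α + qExp (u.symm a) (u.symm b), swap a b * u)) ↔ Moves k u.symm a b := by
  set i := u.symm a with hi
  set j := u.symm b with hj
  have ha : a = u i := by simp [hi]
  have hb : b = u j := by simp [hj]
  have key : i < j → ((invLength (u * swap i j) + 2 * ((j : ℕ) - i) = invLength u + 1) ↔
      ∀ e, i < u.symm e → u.symm e < j → ¬ Cyc a e b) := by
    intro hij
    rw [invLength_mul_swap_of_gt u hij (by rw [← ha, ← hb]; exact h)]
    set F := Finset.univ.filter fun t => i < t ∧ t < j ∧ u j < u t ∧ u t < u i with hF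
    have hsub : F ⊆ Finset.Ioo i j := by
      intro t ht
      simp only [hF, Finset.mem_filter] at ht
      simp [ht]
    have : ∀ m : ℕ, m + 2 * ((j : ℕ) - i) = m + 1 + 2 * F.card + 1 ↔ Finset.Ioo i j ⊆ F := by
      intro m
      constructor
      · intro hm
        refine (Finset.eq_of_subset_of_card_le hsub ?_).ge
        rw [Fin.card_Ioo]
        omega
      · intro hs
        have := Finset.card_le_card hs
        have h' := Finset.card_le_card hsub
        rw [Fin.card_Ioo] at this h'
        omega
    rw [this]
    constructor
    · intro H e h1 h2
      have := H (Finset.mem_Ioo.2 ⟨h1, h2⟩)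
      simp only [hF, Finset.mem_filter] at this
      rw [← ha, ← hb, apply_symm_apply] at this
      rw [Cyc]
      grind
    · intro H t ht
      rw [Finset.mem_Ioo] at ht
      have := H (u t) (by simpa using ht.1) (by simpa using ht.2)
      rw [Cyc] at this
      have n1 : u t ≠ u i := fun e => ht.1.ne' (u.injective e)
      have n2 : u t ≠ u j := fun e => ht.2.ne (u.injective e)
      simp only [hF, Finset.mem_filter]
      grind
  rw [swap_mul_eq, ← hi, ← hj]
  constructor
  · rintro ⟨hij, i', j', hi', hj', hy | hy, hl⟩
    · have hn : (i : ℕ) < n - 1 := by omega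
      have := congrFun (Prod.ext_iff.1 hy).1 ⟨i, hn⟩
      simp [qExp_apply_eq_one (i := i) (j := j) (t := ⟨i, hn⟩) le_rfl hij] at this
    · have e := swap_eq_swap_iff hij.ne (mul_left_cancel (Prod.ext_iff.1 hy).2)
      rcases e with ⟨rfl, rfl⟩ | ⟨rfl, rfl⟩
      · simp only [qLength, Pi.add_apply, Finset.sum_add_distrib, sum_qExp] at hl
        exact ⟨hi', hj', (key hij).1 (by omega)⟩
      · omega
  · rintro ⟨h1, h2, h3⟩
    have hij : i < j := by omega
    refine ⟨hij, i, j, h1, h2, Or.inr rfl, ?_⟩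
    have := (key hij).2 h3
    simp only [qLength, Pi.add_apply, Finset.sum_add_distrib, sum_qExp]
    omega

theorem opAct_eq_some_iff {n : ℕ} {k : Fin (n - 1)} {o : Op n} {x y : SnQ n} :
    opAct k o x = some y ↔ Moves k x.2.symm o.1.1 o.1.2 ∧
      (x.1 + wrapExp x.2.symm o.1.1 o.1.2, swap o.1.1 o.1.2 * x.2) = y := by
  obtain ⟨⟨a, b⟩, hab⟩ := o
  obtain ⟨α, u⟩ := x
  simp only [opAct, wrapExp]
  rcases lt_or_gt_of_ne hab with h | h
  · have hc := qCover_classical_iff (k := k) (α := α) (u := u) h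
    have h' : ¬ b < a := not_lt_of_gt h
    simp only [h', false_and, if_false]
    by_cases hm : Moves k u.symm a b <;> simp_all
  · have hc := qCover_quantum_iff (k := k) (α := α) (u := u) h
    have h' : ¬ a < b := not_lt_of_gt h
    rw [if_neg fun H => h' H.1, if_neg h']
    by_cases hm : Moves k u.symm a b <;> simp_all

/-! ### Words as runs of operators -/

/-- The list of operators, the one acting first standing first, acts as non-zero on a permutation
in which the letter `e` stands at position `p e`. -/
def Run {n : ℕ} (k : Fin (n - 1)) : Perm (Fin n) → List (Op n) → Prop
  | _, [] => True
  | p, o :: l => Moves k p o.1.1 o.1.2 ∧ Run k (p * swap o.1.1 o.1.2) l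

/-- The exponent of the monomial picked up along a list of operators. -/
def runExp {n : ℕ} : Perm (Fin n) → List (Op n) → Fin (n - 1) → ℕ
  | _, [] => 0
  | p, o :: l => wrapExp p o.1.1 o.1.2 + runExp (p * swap o.1.1 o.1.2) l

/-- The product of the transpositions of a list of operators. -/
def runPerm {n : ℕ} : List (Op n) → Perm (Fin n)
  | [] => 1
  | o :: l => runPerm l * swap o.1.1 o.1.2

/-- The operators of a composition, in the order in which they act. -/
def ops {n : ℕ} (w : Word n) : List (Op n) := (FreeMonoid.toList w).reverse

theorem ops_mul {n : ℕ} (w w' : Word n) : ops (w * w') = ops w' ++ ops w := by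
  simp [ops]

theorem ops_injective {n : ℕ} : Function.Injective (ops (n := n)) := fun _ _ h =>
  FreeMonoid.toList.injective (List.reverse_injective h)

theorem length_ops {n : ℕ} (w : Word n) : (ops w).length = w.length := by
  simp [ops, FreeMonoid.length]

theorem act_coe {n : ℕ} (k : Fin (n - 1)) (w : Word n) (x : Option (SnQ n)) :
    act k (w : WithZero (Word n)) x = wordAct k w x := rfl

theorem act_zero {n : ℕ} (k : Fin (n - 1)) (x : Option (SnQ n)) :
    act k (0 : WithZero (Word n)) x = none := rfl

theorem wordAct_none {n : ℕ} (k : Fin (n - 1)) (w : Word n) : wordAct k w none = none := by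
  induction w using FreeMonoid.recOn with
  | one => rfl
  | of_mul o w ih =>
    rw [map_mul]
    change wordAct k (FreeMonoid.of o) (wordAct k w none) = none
    rw [ih]
    rfl

theorem wordAct_eq_some_iff {n : ℕ} {k : Fin (n - 1)} (l : List (Op n)) :
    ∀ {w : Word n} {x y : SnQ n}, ops w = l → (wordAct k w (some x) = some y ↔
      Run k x.2.symm l ∧ (x.1 + runExp x.2.symm l, runPerm l * x.2) = y) := by
  induction l with
  | nil =>
    intro w x y h
    have : w = 1 := ops_injective h
    subst this
    simp only [map_one, Run, runExp, runPerm, true_and, add_zero, one_mul]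
    exact Option.some_inj
  | cons o l ih =>
    intro w x y h
    obtain ⟨w', rfl, hw'⟩ : ∃ w', w = w' * FreeMonoid.of o ∧ ops w' = l := by
      refine ⟨FreeMonoid.ofList l.reverse, ops_injective ?_, ?_⟩
      · rw [h, ops_mul]; simp [ops]
      · simp [ops]
    rw [map_mul]
    change wordAct k w' (opAct k o x) = some y ↔ _
    rcases hz : opAct k o x with _ | z
    · rw [wordAct_none]
      simp only [reduceCtorEq, Run, false_iff]
      intro H
      rw [opAct_eq_some_iff.2 ⟨H.1.1, rfl⟩] at hz
      simp at hz
    · rw [ih hw']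
      obtain ⟨h1, rfl⟩ := opAct_eq_some_iff.1 hz
      simp only [Run, h1, true_and, runExp, runPerm, ← add_assoc, mul_assoc]
      rfl

theorem not_equivalent_zero_iff {n : ℕ} {w : Word n} :
    ¬ Equivalent (w : WithZero (Word n)) 0 ↔ ∃ k p, Run k p (ops w) := by
  simp only [Equivalent, not_forall, act_zero, act_coe]
  refine exists_congr fun k => ⟨fun ⟨u, h⟩ => ?_, fun ⟨p, hp⟩ => ⟨(0, p.symm), ?_⟩⟩
  · obtain ⟨y, hy⟩ := Option.ne_none_iff_exists'.1 h
    exact ⟨_, ((wordAct_eq_some_iff _ rfl).1 hy).1⟩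
  · rw [(wordAct_eq_some_iff (w := w) (x := (0, p.symm)) _ rfl).2 ⟨hp, rfl⟩]
    simp

/-- Equality of the actions of two words, in terms of their operators. -/
theorem equivalent_iff {n : ℕ} {w w' : Word n} :
    Equivalent (w : WithZero (Word n)) w' ↔ ∀ k p, (Run k p (ops w) ↔ Run k p (ops w')) ∧
      (Run k p (ops w) → runExp p (ops w) = runExp p (ops w') ∧
        runPerm (ops w) = runPerm (ops w')) := by
  simp only [Equivalent, act_coe]
  constructor
  · intro H k p
    -- Trivial monomials suffice as tests, since the initial monomial only shifts the exponent. The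
    -- position map `p` is the inverse of the permutation acted on, so left multiplication by a
    -- transposition becomes right multiplication.
    have h := H k (0, p.symm)
    have key : ∀ w₁ w₂ : Word n, wordAct k w₁ (some (0, p.symm)) = wordAct k w₂ (some (0, p.symm)) →
        Run k p (ops w₁) → Run k p (ops w₂) ∧
          runExp p (ops w₁) = runExp p (ops w₂) ∧ runPerm (ops w₁) = runPerm (ops w₂) := by
      intro w₁ w₂ h h1
      have e1 := (wordAct_eq_some_iff (w := w₁) (x := (0, p.symm)) _ rfl).2 ⟨h1, rfl⟩
      obtain ⟨h2, h3⟩ := (wordAct_eq_some_iff (w := w₂) (x := (0, p.symm)) _ rfl).1 (h.symm.trans e1)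
      have h3 := Prod.ext_iff.1 h3
      simp only [zero_add, symm_symm, mul_left_inj] at h3
      exact ⟨h2, h3.1.symm, h3.2.symm⟩
    exact ⟨⟨fun h1 => (key w w' h h1).1, fun h1 => (key w' w h.symm h1).1⟩,
      fun h1 => (key w w' h h1).2⟩
  · intro H k x
    obtain ⟨h1, h2⟩ := H k x.2.symm
    ext y
    simp only [wordAct_eq_some_iff _ rfl]
    rw [← h1]
    refine and_congr_right fun h => ?_
    rw [(h2 h).1, (h2 h).2]

/-! ### Two consecutive operators -/

/-- Reindexing the blocking letters by `q` expresses every condition of a run through the initial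
positions `p e`. -/
theorem moves_mul_swap_iff {n : ℕ} {k : Fin (n - 1)} {p q : Perm (Fin n)} {c d : Fin n} :
    Moves k (p * q) c d ↔ (p (q c) : ℕ) ≤ k ∧ (k : ℕ) < p (q d) ∧
      ∀ e, p (q c) < p e → p e < p (q d) → ¬ Cyc c (q.symm e) d := by
  refine and_congr_right fun _ => and_congr_right fun _ => ⟨fun H e => ?_, fun H e => ?_⟩
  · simpa using H (q.symm e)
  · simpa using H (q e)

/-- After the first step `b` stands left of the cut and `a` right of it, which excludes `c = a` and
`d = b`. In the other cases a violation would put one of `a`, `b`, `c`, `d` between the two moved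
positions with a forbidden value; for disjoint letters the conclusion says that the chords `ab` and
`cd` of the circle do not cross. -/
theorem Moves.ok {n : ℕ} {k : Fin (n - 1)} {p : Perm (Fin n)} {a b c d : Fin n}
    (hab : a ≠ b) (hcd : c ≠ d) (h₁ : Moves k p a b) (h₂ : Moves k (p * swap a b) c d) :
    c ≠ a ∧ d ≠ b ∧ (c = b → d ≠ a → ¬ Cyc a d b) ∧ (d = a → c ≠ b → ¬ Cyc a c b) ∧
    (c ≠ b → d ≠ a → (Cyc a c b ↔ Cyc a d b)) := by
  obtain ⟨h1, h2, h3⟩ := h₁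
  obtain ⟨h4, h5, h6⟩ := h₂
  have hp : ∀ x y, p x = p y → x = y := fun x y e => p.injective e
  have ea := h6 a
  have eb := h6 b
  have fc := h3 c
  have fd := h3 d
  simp only [Perm.mul_apply, swap_apply_left, swap_apply_right] at *
  simp only [Cyc, swap_apply_def] at *
  have := hp a c
  have := hp a d
  have := hp b c
  have := hp b d
  refine ⟨?_, ?_, ?_, ?_, ?_⟩ <;> grind

/-- With disjoint, non-crossing chords, either interval contains both letters of the other pair or
neither, so exchanging those letters does not affect whether the other move is blocked. -/
theorem Moves.comm {n : ℕ} {k : Fin (n - 1)} {p : Perm (Fin n)} {a b c d : Fin n}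
    (hca : c ≠ a) (hcb : c ≠ b) (hda : d ≠ a) (hdb : d ≠ b) (hab : a ≠ b)
    (h : (Cyc a c b ↔ Cyc a d b))
    (h₁ : Moves k p a b) (h₂ : Moves k (p * swap a b) c d) :
    Moves k p c d ∧ Moves k (p * swap c d) a b := by
  rw [moves_mul_swap_iff] at *
  obtain ⟨h1, h2, h3⟩ := h₁
  obtain ⟨h4, h5, h6⟩ := h₂
  have hp : ∀ x y, p x = p y → x = y := fun x y e => p.injective e
  simp only [swap_apply_of_ne_of_ne, symm_swap, *, ne_eq, Ne.symm, not_false_iff] at *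
  have ea := h6 a
  have eb := h6 b
  have fc := h3 c
  have fd := h3 d
  simp only [swap_apply_left, swap_apply_right] at ea eb
  refine ⟨⟨h4, h5, fun e he he' => ?_⟩, by grind, by grind, fun e he he' => ?_⟩
  · have := h6 e
    rw [swap_apply_def] at this
    simp only [Cyc] at *
    grind
  · have := h3 e
    rw [swap_apply_def]
    simp only [Cyc] at *
    grind

/-! ### Both sides of the relations act as non-zero simultaneously -/

theorem Cyc.mem_iff {a b c e : ℕ} (h : Cyc a b c) (he : e ≠ b) (hac : a ≠ c) :
    Cyc a e c ↔ Cyc a e b ∨ Cyc b e c := by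
  unfold Cyc at *
  omega

theorem forall_iff_letters {ι : Type*} {P : ι → Prop} (a b c d : ι) :
    (∀ e, P e) ↔ P a ∧ P b ∧ P c ∧ P d ∧ ∀ e, e ≠ a → e ≠ b → e ≠ c → e ≠ d → P e := by
  refine ⟨fun h => ⟨h a, h b, h c, h d, fun e _ _ _ _ => h e⟩, fun ⟨ha, hb, hc, hd, h⟩ e => ?_⟩
  by_cases e = a <;> by_cases e = b <;> by_cases e = c <;> by_cases e = d <;> simp_all

/-- Separates the four named letters, whose cyclic conditions are known, from the remaining ones,
which `q` fixes in the applications. -/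
theorem moves_letters {n : ℕ} {k : Fin (n - 1)} {p q : Perm (Fin n)} {x y : Fin n}
    (a b c d : Fin n) : Moves k (p * q) x y ↔ (p (q x) : ℕ) ≤ k ∧ (k : ℕ) < p (q y) ∧
      (p (q x) < p a → p a < p (q y) → ¬ Cyc x (q⁻¹ a) y) ∧
      (p (q x) < p b → p b < p (q y) → ¬ Cyc x (q⁻¹ b) y) ∧
      (p (q x) < p c → p c < p (q y) → ¬ Cyc x (q⁻¹ c) y) ∧
      (p (q x) < p d → p d < p (q y) → ¬ Cyc x (q⁻¹ d) y) ∧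
      ∀ e, e ≠ a → e ≠ b → e ≠ c → e ≠ d →
        p (q x) < p e → p e < p (q y) → ¬ Cyc x (q⁻¹ e) y := by
  rw [moves_mul_swap_iff, forall_iff_letters a b c d]
  rfl

theorem moves_letters_one {n : ℕ} {k : Fin (n - 1)} {p : Perm (Fin n)} {x y : Fin n}
    (a b c d : Fin n) : Moves k p x y ↔ (p x : ℕ) ≤ k ∧ (k : ℕ) < p y ∧
      (p x < p a → p a < p y → ¬ Cyc x a y) ∧
      (p x < p b → p b < p y → ¬ Cyc x b y) ∧
      (p x < p c → p c < p y → ¬ Cyc x c y) ∧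
      (p x < p d → p d < p y → ¬ Cyc x d y) ∧
      ∀ e, e ≠ a → e ≠ b → e ≠ c → e ≠ d → p x < p e → p e < p y → ¬ Cyc x e y := by
  rw [Moves, forall_iff_letters a b c d]

/-- On the left the forbidden rectangles, positions times letters, are `(pa, pb) × (a, b)`, `(pa,
pc) × (b, c)` and `(pd, pc) × (d, b)`; on the right they are `(pa, pc) × (a, c)`, `(pd, pc) × (d,
a)` and `(pd, pb) × (a, b)`. All position intervals straddle the cut, so for letters in `(a, b)`
both unions span from the leftmost to the rightmost end; the other letters meet the same intervals
on both sides. For the named letters both sides force `p c < p b`. -/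
theorem moves_outer {n : ℕ} {k : Fin (n - 1)} {p : Perm (Fin n)} {a b c d : Fin n}
    (h : Cyc a b c) (hac : a ≠ c) (had : a ≠ d) (hd : Cyc c d a) :
    (Moves k p a b ∧ Moves k (p * swap a b) b c ∧ Moves k (p * swap a b * swap b c) d b) ↔
    (Moves k p a c ∧ Moves k (p * swap a c) d a ∧ Moves k (p * swap a c * swap d a) a b) := by
  have hab : a ≠ b := by rintro rfl; simp [Cyc] at h; omega
  have hbc : b ≠ c := by rintro rfl; simp [Cyc] at h; omega
  have hbd : b ≠ d := by rintro rfl; simp [Cyc] at h hd; omega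
  have hcd : c ≠ d := by rintro rfl; simp [Cyc] at h hd; omega
  have c1 : ¬ Cyc a c b := by unfold Cyc at *; omega
  have c2 : ¬ Cyc a d b := by unfold Cyc at *; omega
  have c3 : ¬ Cyc b a c := by unfold Cyc at *; omega
  have c4 : ¬ Cyc b d c := by unfold Cyc at *; omega
  have c5 : Cyc d a b := by unfold Cyc at *; omega
  have c6 : ¬ Cyc d c b := by unfold Cyc at *; omega
  have c7 : ¬ Cyc a d c := by unfold Cyc at *; omega
  have c8 : ¬ Cyc d c a := by unfold Cyc at *; omega
  have c9 : ¬ Cyc d b a := by unfold Cyc at *; omega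
  have m1 : ∀ e : Fin n, e ≠ b → (Cyc a e c ↔ Cyc a e b ∨ Cyc b e c) :=
    fun e he => h.mem_iff (by omega) (by omega)
  have m2 : ∀ e : Fin n, e ≠ a → (Cyc d e b ↔ Cyc d e a ∨ Cyc a e b) :=
    fun e he => c5.mem_iff (by omega) (by omega)
  rw [mul_assoc, mul_assoc, moves_letters_one (p := p) a b c d, moves_letters_one (p := p) a b c d,
    moves_letters a b c d, moves_letters a b c d, moves_letters a b c d, moves_letters a b c d]
  simp only [mul_inv_rev, swap_inv, Perm.mul_apply, swap_apply_left, swap_apply_right,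
    swap_apply_of_ne_of_ne, ne_eq, hab, hac, hbc, hbd, hcd, hab.symm, hac.symm, had.symm, hbc.symm,
    hbd.symm, hcd.symm, not_false_eq_true, c1, c2, c3, c4, c5, c6, c7, c8, c9, h, not_true_eq_false,
    lt_self_iff_false, false_imp_iff, imp_true_iff, true_and]
  simp +contextual only [swap_apply_of_ne_of_ne, ne_eq, not_false_eq_true]
  constructor
  · rintro ⟨⟨h1, h2, h3⟩, ⟨h4, h5, h6⟩, h7, h8, h9, h10⟩
    refine ⟨⟨h4, h5, fun _ _ => h9 (by omega) (by omega), fun e e1 e2 e3 e4 => ?_⟩,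
      ⟨h7, h8, fun e e1 e2 e3 e4 => ?_⟩, by omega, by omega, fun e e1 e2 e3 e4 => ?_⟩ <;>
    · have q1 := h3 e e1 e2 e3 e4
      have q2 := h6 e e1 e2 e3 e4
      have q3 := h10 e e1 e2 e3 e4
      have := m1 e e2
      have := m2 e e1
      clear h3 h6 h10 m1 m2
      grind
  · rintro ⟨⟨h1, h2, h3, h4⟩, ⟨h5, h6, h7⟩, h8, h9, h10⟩
    refine ⟨⟨by omega, by omega, fun e e1 e2 e3 e4 => ?_⟩, ⟨h1, h2, fun e e1 e2 e3 e4 => ?_⟩, h5, h6,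
      fun _ _ => h3 (by omega) (by omega), fun e e1 e2 e3 e4 => ?_⟩ <;>
    · have q1 := h4 e e1 e2 e3 e4
      have q2 := h7 e e1 e2 e3 e4
      have q3 := h10 e e1 e2 e3 e4
      have := m1 e e2
      have := m2 e e1
      clear h4 h7 h10 m1 m2
      grind

/-- The case `d = c` of the same comparison of rectangles: when `d` would move, `c` stands where `a`
stood at first, so `p a` plays the role of `p d`. -/
theorem moves_outer_degenerate {n : ℕ} {k : Fin (n - 1)} {p : Perm (Fin n)} {a b c : Fin n}
    (h : Cyc a b c) (hac : a ≠ c) :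
    (Moves k p a b ∧ Moves k (p * swap a b) b c ∧ Moves k (p * swap a b * swap b c) c b) ↔
    (Moves k p a c ∧ Moves k (p * swap a c) c a ∧ Moves k (p * swap a c * swap c a) a b) := by
  have hab : a ≠ b := by rintro rfl; simp [Cyc] at h; omega
  have hbc : b ≠ c := by rintro rfl; simp [Cyc] at h; omega
  have c1 : ¬ Cyc a c b := by unfold Cyc at *; omega
  have c3 : ¬ Cyc b a c := by unfold Cyc at *; omega
  have c5 : Cyc c a b := by unfold Cyc at *; omega
  have c9 : ¬ Cyc c b a := by unfold Cyc at *; omega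
  have m1 : ∀ e : Fin n, e ≠ b → (Cyc a e c ↔ Cyc a e b ∨ Cyc b e c) :=
    fun e he => h.mem_iff (by omega) (by omega)
  have m2 : ∀ e : Fin n, e ≠ a → (Cyc c e b ↔ Cyc c e a ∨ Cyc a e b) :=
    fun e he => c5.mem_iff (by omega) (by omega)
  rw [mul_assoc, mul_assoc, moves_letters_one (p := p) a b c c, moves_letters_one (p := p) a b c c,
    moves_letters a b c c, moves_letters a b c c, moves_letters a b c c, moves_letters a b c c]
  simp only [mul_inv_rev, swap_inv, Perm.mul_apply, swap_apply_left, swap_apply_right,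
    swap_apply_of_ne_of_ne, ne_eq, hab, hac, hbc, hab.symm, hac.symm, hbc.symm,
    not_false_eq_true, c1, c3, c5, c9, h, not_true_eq_false,
    lt_self_iff_false, false_imp_iff, imp_true_iff, true_and]
  simp +contextual only [swap_apply_of_ne_of_ne, ne_eq, not_false_eq_true]
  constructor
  · rintro ⟨⟨h1, h2, h3⟩, ⟨h4, h5, h6⟩, h7, h8, h9, h10⟩
    refine ⟨⟨h4, h5, fun _ _ => h9 (by omega) (by omega), fun e e1 e2 e3 e4 => ?_⟩,
      ⟨h7, h8, fun e e1 e2 e3 e4 => ?_⟩, by omega, by omega, fun e e1 e2 e3 e4 => ?_⟩ <;>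
    · have q1 := h3 e e1 e2 e3 e4
      have q2 := h6 e e1 e2 e3 e4
      have q3 := h10 e e1 e2 e3 e4
      have := m1 e e2
      have := m2 e e1
      clear h3 h6 h10 m1 m2
      grind
  · rintro ⟨⟨h1, h2, h3, h4⟩, ⟨h5, h6, h7⟩, h8, h9, h10⟩
    refine ⟨⟨by omega, by omega, fun e e1 e2 e3 e4 => ?_⟩, ⟨h1, h2, fun e e1 e2 e3 e4 => ?_⟩, h5, h6,
      fun _ _ => h3 (by omega) (by omega), fun e e1 e2 e3 e4 => ?_⟩ <;>
    · have q1 := h4 e e1 e2 e3 e4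
      have q2 := h7 e e1 e2 e3 e4
      have q3 := h10 e e1 e2 e3 e4
      have := m1 e e2
      have := m2 e e1
      clear h4 h7 h10 m1 m2
      grind

/-- The mirror image of `moves_outer` under reversal of positions and letters; the condition on the
named letters is now `p c < p b` with both positions left of the cut. -/
theorem moves_inner {n : ℕ} {k : Fin (n - 1)} {p : Perm (Fin n)} {a b c d : Fin n}
    (h : Cyc b c d) (hbd : b ≠ d) (had : a ≠ d) (hd : Cyc d a b) :
    (Moves k p c d ∧ Moves k (p * swap c d) b c ∧ Moves k (p * swap c d * swap b c) c a) ↔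
    (Moves k p b d ∧ Moves k (p * swap b d) d a ∧ Moves k (p * swap b d * swap d a) c d) := by
  have hbc : b ≠ c := by rintro rfl; simp [Cyc] at h; omega
  have hcd : c ≠ d := by rintro rfl; simp [Cyc] at h; omega
  have hac : a ≠ c := by rintro rfl; simp [Cyc] at h hd; omega
  have hab : a ≠ b := by rintro rfl; simp [Cyc] at h hd; omega
  have c1 : ¬ Cyc c a d := by unfold Cyc at *; omega
  have c2 : ¬ Cyc c b d := by unfold Cyc at *; omega
  have c3 : ¬ Cyc b a c := by unfold Cyc at *; omega
  have c4 : ¬ Cyc b d c := by unfold Cyc at *; omega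
  have c5 : Cyc c d a := by unfold Cyc at *; omega
  have c6 : ¬ Cyc c b a := by unfold Cyc at *; omega
  have c7 : ¬ Cyc b a d := by unfold Cyc at *; omega
  have c8 : ¬ Cyc d c a := by unfold Cyc at *; omega
  have c9 : ¬ Cyc d b a := by unfold Cyc at *; omega
  have m1 : ∀ e : Fin n, e ≠ c → (Cyc b e d ↔ Cyc b e c ∨ Cyc c e d) :=
    fun e he => h.mem_iff (by omega) (by omega)
  have m2 : ∀ e : Fin n, e ≠ d → (Cyc c e a ↔ Cyc c e d ∨ Cyc d e a) :=
    fun e he => c5.mem_iff (by omega) (by omega)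
  rw [mul_assoc, mul_assoc, moves_letters_one (p := p) a b c d, moves_letters_one (p := p) a b c d,
    moves_letters a b c d, moves_letters a b c d, moves_letters a b c d, moves_letters a b c d]
  simp only [mul_inv_rev, swap_inv, Perm.mul_apply, swap_apply_left, swap_apply_right,
    swap_apply_of_ne_of_ne, ne_eq, hab, hac, had, hbc, hbd, hcd, hab.symm, hac.symm, hbc.symm,
    hbd.symm, hcd.symm, not_false_eq_true, c1, c2, c3, c4, c5, c6, c7, c8, c9, h, not_true_eq_false,
    lt_self_iff_false, false_imp_iff, imp_true_iff, true_and]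
  simp +contextual only [swap_apply_of_ne_of_ne, ne_eq, not_false_eq_true]
  constructor
  · rintro ⟨⟨h1, h2, h3⟩, ⟨h4, h5, h6⟩, h7, h8, h9, h10⟩
    refine ⟨⟨h4, h5, fun _ _ => h9 (by omega) (by omega), fun e e1 e2 e3 e4 => ?_⟩,
      ⟨h7, h8, fun e e1 e2 e3 e4 => ?_⟩, by omega, by omega, fun e e1 e2 e3 e4 => ?_⟩ <;>
    · have q1 := h3 e e1 e2 e3 e4
      have q2 := h6 e e1 e2 e3 e4
      have q3 := h10 e e1 e2 e3 e4
      have := m1 e e3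
      have := m2 e e4
      clear h3 h6 h10 m1 m2
      grind
  · rintro ⟨⟨h1, h2, h3, h4⟩, ⟨h5, h6, h7⟩, h8, h9, h10⟩
    refine ⟨⟨by omega, by omega, fun e e1 e2 e3 e4 => ?_⟩, ⟨h1, h2, fun e e1 e2 e3 e4 => ?_⟩, h5, h6,
      fun _ _ => h3 (by omega) (by omega), fun e e1 e2 e3 e4 => ?_⟩ <;>
    · have q1 := h4 e e1 e2 e3 e4
      have q2 := h7 e e1 e2 e3 e4
      have q3 := h10 e e1 e2 e3 e4
      have := m1 e e3
      have := m2 e e4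
      clear h4 h7 h10 m1 m2
      grind

theorem moves_inner_degenerate {n : ℕ} {k : Fin (n - 1)} {p : Perm (Fin n)} {b c d : Fin n}
    (h : Cyc b c d) (hbd : b ≠ d) :
    (Moves k p c d ∧ Moves k (p * swap c d) b c ∧ Moves k (p * swap c d * swap b c) c b) ↔
    (Moves k p b d ∧ Moves k (p * swap b d) d b ∧ Moves k (p * swap b d * swap d b) c d) := by
  have hbc : b ≠ c := by rintro rfl; simp [Cyc] at h; omega
  have hcd : c ≠ d := by rintro rfl; simp [Cyc] at h; omega
  have c1 : ¬ Cyc c b d := by unfold Cyc at *; omega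
  have c4 : ¬ Cyc b d c := by unfold Cyc at *; omega
  have c5 : Cyc c d b := by unfold Cyc at *; omega
  have c8 : ¬ Cyc d c b := by unfold Cyc at *; omega
  have m1 : ∀ e : Fin n, e ≠ c → (Cyc b e d ↔ Cyc b e c ∨ Cyc c e d) :=
    fun e he => h.mem_iff (by omega) (by omega)
  have m2 : ∀ e : Fin n, e ≠ d → (Cyc c e b ↔ Cyc c e d ∨ Cyc d e b) :=
    fun e he => c5.mem_iff (by omega) (by omega)
  rw [mul_assoc, mul_assoc, moves_letters_one (p := p) b c d d, moves_letters_one (p := p) b c d d,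
    moves_letters b c d d, moves_letters b c d d, moves_letters b c d d, moves_letters b c d d]
  simp only [mul_inv_rev, swap_inv, Perm.mul_apply, swap_apply_left, swap_apply_right,
    swap_apply_of_ne_of_ne, ne_eq, hbc, hbd, hcd, hbc.symm,
    hbd.symm, hcd.symm, not_false_eq_true, c1, c4, c5, c8, h, not_true_eq_false,
    lt_self_iff_false, false_imp_iff, imp_true_iff, true_and]
  simp +contextual only [swap_apply_of_ne_of_ne, ne_eq, not_false_eq_true]
  constructor
  · rintro ⟨⟨h1, h2, h3⟩, ⟨h4, h5, h6⟩, h7, h8, h9, h10⟩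
    refine ⟨⟨h4, h5, fun _ _ => h9 (by omega) (by omega), fun e e1 e2 e3 e4 => ?_⟩,
      ⟨h7, h8, fun e e1 e2 e3 e4 => ?_⟩, by omega, by omega, fun e e1 e2 e3 e4 => ?_⟩ <;>
    · have q1 := h3 e e1 e2 e3 e4
      have q2 := h6 e e1 e2 e3 e4
      have q3 := h10 e e1 e2 e3 e4
      have := m1 e e2
      have := m2 e e3
      clear h3 h6 h10 m1 m2
      grind
  · rintro ⟨⟨h1, h2, h3, h4⟩, ⟨h5, h6, h7⟩, h8, h9, h10⟩
    refine ⟨⟨by omega, by omega, fun e e1 e2 e3 e4 => ?_⟩, ⟨h1, h2, fun e e1 e2 e3 e4 => ?_⟩, h5, h6,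
      fun _ _ => h3 (by omega) (by omega), fun e e1 e2 e3 e4 => ?_⟩ <;>
    · have q1 := h4 e e1 e2 e3 e4
      have q2 := h7 e e1 e2 e3 e4
      have q3 := h10 e e1 e2 e3 e4
      have := m1 e e2
      have := m2 e e3
      clear h4 h7 h10 m1 m2
      grind

/-! ### Monomials and permutations of the two sides -/

/-- If the alphabet ends between `b` and `c` or between `d` and `a`, both sides pick up the same
single monomial, and if it ends between `c` and `d` there is none. If it ends between `a` and `b`,
the claim is that the intervals from `pa` to `pb` and from `pd` to `pc` may exchange right ends,
which holds as both contain the cut. -/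
theorem wrapExp_outer {n : ℕ} {k : Fin (n - 1)} {p : Perm (Fin n)} {a b c d : Fin n}
    (h : Cyc a b c) (hac : a ≠ c) (had : a ≠ d) (hd : d = c ∨ Cyc c d a)
    (h₁ : Moves k p a b) (h₂ : Moves k (p * swap a b) b c)
    (h₃ : Moves k (p * swap a b * swap b c) d b) :
    wrapExp p a b + (wrapExp (p * swap a b) b c + wrapExp (p * swap a b * swap b c) d b) =
    wrapExp p a c + (wrapExp (p * swap a c) d a + wrapExp (p * swap a c * swap d a) a b) := by
  have hab : a ≠ b := by rintro rfl; simp [Cyc] at h; omega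
  have hbc : b ≠ c := by rintro rfl; simp [Cyc] at h; omega
  have hbd : b ≠ d := by rintro rfl; simp [Cyc] at h hd; omega
  -- Only the sides of the cut on which the letters stand matter for the monomial.
  replace h₁ := And.intro h₁.1 h₁.2.1
  replace h₂ := And.intro h₂.1 h₂.2.1
  replace h₃ := And.intro h₃.1 h₃.2.1
  rcases hd with rfl | hd
  · simp only [Perm.mul_apply, swap_apply_left, swap_apply_right, swap_apply_of_ne_of_ne, ne_eq,
      hab, hac, hbc, hab.symm, hac.symm, hbc.symm, not_false_eq_true, wrapExp] at *
    simp only [Cyc] at *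
    ext t
    split_ifs <;> simp only [Pi.add_apply, Pi.zero_apply, qExp] <;> grind
  · have hcd : c ≠ d := by rintro rfl; simp [Cyc] at h hd; omega
    simp only [Perm.mul_apply, swap_apply_left, swap_apply_right, swap_apply_of_ne_of_ne, ne_eq,
      hab, hac, hbc, had, hbd, hcd, hab.symm, hac.symm, hbc.symm, had.symm, hbd.symm, hcd.symm,
      not_false_eq_true, wrapExp] at *
    simp only [Cyc] at *
    ext t
    split_ifs <;> simp only [Pi.add_apply, Pi.zero_apply, qExp] <;> grind

theorem wrapExp_inner {n : ℕ} {k : Fin (n - 1)} {p : Perm (Fin n)} {a b c d : Fin n}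
    (h : Cyc b c d) (hbd : b ≠ d) (had : a ≠ d) (hd : a = b ∨ Cyc d a b)
    (h₁ : Moves k p c d) (h₂ : Moves k (p * swap c d) b c)
    (h₃ : Moves k (p * swap c d * swap b c) c a) :
    wrapExp p c d + (wrapExp (p * swap c d) b c + wrapExp (p * swap c d * swap b c) c a) =
    wrapExp p b d + (wrapExp (p * swap b d) d a + wrapExp (p * swap b d * swap d a) c d) := by
  have hbc : b ≠ c := by rintro rfl; simp [Cyc] at h; omega
  have hcd : c ≠ d := by rintro rfl; simp [Cyc] at h; omega
  have hac : a ≠ c := by rintro rfl; simp [Cyc] at h hd; omega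
  replace h₁ := And.intro h₁.1 h₁.2.1
  replace h₂ := And.intro h₂.1 h₂.2.1
  replace h₃ := And.intro h₃.1 h₃.2.1
  rcases hd with rfl | hd
  · simp only [Perm.mul_apply, swap_apply_left, swap_apply_right, swap_apply_of_ne_of_ne, ne_eq,
      hac, hcd, hbd, hac.symm, not_false_eq_true, wrapExp] at *
    simp only [Cyc] at *
    ext t
    split_ifs <;> simp only [Pi.add_apply, Pi.zero_apply, qExp] <;> grind
  · have hab : a ≠ b := by rintro rfl; simp [Cyc] at h hd; omega
    simp only [Perm.mul_apply, swap_apply_left, swap_apply_right, swap_apply_of_ne_of_ne, ne_eq,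
      hab, hac, hbc, had, hbd, hcd, hac.symm, hbc.symm,
      not_false_eq_true, wrapExp] at *
    simp only [Cyc] at *
    ext t
    split_ifs <;> simp only [Pi.add_apply, Pi.zero_apply, qExp] <;> grind

theorem swap_prod_outer {n : ℕ} {a b c d : Fin n} (hab : a ≠ b) (hac : a ≠ c) (hbc : b ≠ c)
    (had : a ≠ d) (hbd : b ≠ d) :
    swap d b * swap b c * swap a b = swap a b * swap d a * swap a c := by
  ext e
  simp only [Perm.mul_apply, swap_apply_def]
  grind

theorem swap_prod_inner {n : ℕ} {a b c d : Fin n} (hac : a ≠ c) (had : a ≠ d) (hbc : b ≠ c)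
    (hbd : b ≠ d) (hcd : c ≠ d) :
    swap c a * swap b c * swap c d = swap c d * swap d a * swap b d := by
  ext e
  simp only [Perm.mul_apply, swap_apply_def]
  grind

/-! ### The motion of a position -/

/-- The letter that replaces `c` under the transposition of `o`. -/
def moveLetter (o : ℕ × ℕ) (c : ℕ) : ℕ :=
  bif Nat.beq c o.1 then o.2 else bif Nat.beq c o.2 then o.1 else c

/-- The letter that ends up at the position at which `c` stands at first. -/
def finalLetter (l : List (ℕ × ℕ)) : ℕ → ℕ :=
  List.rec (motive := fun _ => ℕ → ℕ) (fun c => c) (fun o _ ih c => ih (moveLetter o c)) l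

/-- How often the position at which `c` stands at first is the left one of a quantum step. -/
def upTurns (l : List (ℕ × ℕ)) : ℕ → ℕ :=
  List.rec (motive := fun _ => ℕ → ℕ) (fun _ => 0) (fun o _ ih c =>
    (bif Nat.beq c o.1 && Nat.blt o.2 o.1 then 1 else 0) + ih (moveLetter o c)) l

/-- How often the position at which `c` stands at first is the right one of a quantum step. -/
def downTurns (l : List (ℕ × ℕ)) : ℕ → ℕ :=
  List.rec (motive := fun _ => ℕ → ℕ) (fun _ => 0) (fun o _ ih c =>
    (bif Nat.beq c o.2 && Nat.blt o.2 o.1 then 1 else 0) + ih (moveLetter o c)) l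

theorem finalLetter_nil (c : ℕ) : finalLetter [] c = c := rfl

theorem finalLetter_cons (o : ℕ × ℕ) (l : List (ℕ × ℕ)) (c : ℕ) :
    finalLetter (o :: l) c = finalLetter l (moveLetter o c) := rfl

theorem upTurns_nil (c : ℕ) : upTurns [] c = 0 := rfl

theorem upTurns_cons (o : ℕ × ℕ) (l : List (ℕ × ℕ)) (c : ℕ) : upTurns (o :: l) c =
    (bif Nat.beq c o.1 && Nat.blt o.2 o.1 then 1 else 0) + upTurns l (moveLetter o c) := rfl

theorem downTurns_nil (c : ℕ) : downTurns [] c = 0 := rfl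

theorem downTurns_cons (o : ℕ × ℕ) (l : List (ℕ × ℕ)) (c : ℕ) : downTurns (o :: l) c =
    (bif Nat.beq c o.2 && Nat.blt o.2 o.1 then 1 else 0) + downTurns l (moveLetter o c) := rfl

/-- An operator as a pair of natural numbers. -/
def code {n : ℕ} (o : Op n) : ℕ × ℕ := (o.1.1, o.1.2)

theorem code_injective {n : ℕ} : Function.Injective (code (n := n)) := by
  rintro ⟨⟨a, b⟩, h⟩ ⟨⟨c, d⟩, h'⟩ e
  simp only [code, Prod.mk.injEq, Fin.val_inj] at e
  simp [e.1, e.2]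

theorem moveLetter_eq (o : ℕ × ℕ) (c : ℕ) :
    moveLetter o c = if c = o.1 then o.2 else if c = o.2 then o.1 else c := by
  simp only [moveLetter, cond_eq_ite, Nat.beq_eq]

theorem moveLetter_code {n : ℕ} (o : Op n) (c : Fin n) :
    moveLetter (code o) c = swap o.1.1 o.1.2 c := by
  rw [moveLetter_eq, swap_apply_def]
  simp only [code, Fin.val_inj]
  split_ifs <;> rfl

theorem finalLetter_code {n : ℕ} (l : List (Op n)) (c : Fin n) :
    finalLetter (l.map code) c = runPerm l c := by
  induction l generalizing c with
  | nil => rfl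
  | cons o l ih =>
    rw [List.map_cons, finalLetter_cons, moveLetter_code, ih]
    rfl

/-- A quantum step between positions `i < j` contributes to coordinate `s` the indicator of `i ≤ s`
minus that of `j ≤ s`, so the exponent at `s` is the net number of turns at the positions up to `s`.
For `s ≥ n - 1` all positions are counted and the turns cancel, which matches the default value
zero. -/
theorem turns_eq {n : ℕ} {k : Fin (n - 1)} (l : List (Op n)) (p : Perm (Fin n)) (h : Run k p l)
    (s : ℕ) : (if hs : s < n - 1 then runExp p l ⟨s, hs⟩ else 0) +
      ∑ c : Fin n, (if (p c : ℕ) ≤ s then downTurns (l.map code) c else 0) =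
      ∑ c : Fin n, (if (p c : ℕ) ≤ s then upTurns (l.map code) c else 0) := by
  induction l generalizing p with
  | nil => simp [runExp, downTurns_nil, upTurns_nil]
  | cons o l ih =>
    obtain ⟨hm, hr⟩ := h
    have ih := ih _ hr
    -- After the step, the position of `c` carries the letter `swap o.1.1 o.1.2 c`; the rest of the
    -- count is reindexed accordingly.
    have split : ∀ (f : ℕ → ℕ) (a : Fin n) (P : Prop) [Decidable P],
        ∑ c : Fin n, (if (p c : ℕ) ≤ s then
          (if (c : ℕ) = a ∧ P then 1 else 0) + f (swap o.1.1 o.1.2 c) else 0) =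
        (if (p a : ℕ) ≤ s ∧ P then 1 else 0) +
        ∑ c : Fin n, if ((p * swap o.1.1 o.1.2) c : ℕ) ≤ s then f c else 0 := by
      intro f a P _
      rw [← Equiv.sum_comp (swap o.1.1 o.1.2) (fun c : Fin n =>
        if ((p * swap o.1.1 o.1.2) c : ℕ) ≤ s then f c else 0)]
      simp only [Perm.mul_apply, swap_apply_self]
      have : (if (p a : ℕ) ≤ s ∧ P then 1 else 0) =
          ∑ c : Fin n, if c = a then (if (p a : ℕ) ≤ s ∧ P then 1 else 0) else 0 := by
        simp
      rw [this, ← Finset.sum_add_distrib]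
      refine Finset.sum_congr rfl fun c _ => ?_
      by_cases hc : c = a
      · subst hc
        by_cases h1 : (p c : ℕ) ≤ s <;> simp [h1]
      · have : (c : ℕ) ≠ a := fun e => hc (Fin.ext e)
        simp [hc, this]
    simp only [List.map_cons, downTurns_cons, upTurns_cons, moveLetter_code, cond_eq_ite, Bool.and_eq_true,
      Nat.beq_eq, Nat.blt_eq]
    refine (congrArg (_ + ·) (split (downTurns (l.map code)) o.1.2 ((o.1.2 : ℕ) < o.1.1))).trans
      (Eq.trans ?_ (split (upTurns (l.map code)) o.1.1 ((o.1.2 : ℕ) < o.1.1)).symm)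
    have hw : (if hs : s < n - 1 then wrapExp p o.1.1 o.1.2 ⟨s, hs⟩ else 0) +
        (if (p o.1.2 : ℕ) ≤ s ∧ (o.1.2 : ℕ) < o.1.1 then 1 else 0) =
        (if (p o.1.1 : ℕ) ≤ s ∧ (o.1.2 : ℕ) < o.1.1 then 1 else 0) := by
      obtain ⟨h1, h2, -⟩ := hm
      have h3 := o.2
      simp only [wrapExp]
      split_ifs <;> (try simp only [qExp, Pi.zero_apply]) <;> grind
    have hsum : (if hs : s < n - 1 then runExp p (o :: l) ⟨s, hs⟩ else 0) =
        (if hs : s < n - 1 then wrapExp p o.1.1 o.1.2 ⟨s, hs⟩ else 0) +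
        (if hs : s < n - 1 then runExp (p * swap o.1.1 o.1.2) l ⟨s, hs⟩ else 0) := by
      split_ifs <;> rfl
    omega

theorem eq_of_prefix_sums_eq {n : ℕ} (f g : Fin n → ℕ)
    (h : ∀ s : ℕ, ∑ q : Fin n, (if (q : ℕ) ≤ s then f q else 0) = ∑ q : Fin n, if (q : ℕ) ≤ s then g q else 0) :
    f = g := by
  have key : ∀ (f : Fin n → ℕ) (q : Fin n), ∑ t : Fin n, (if (t : ℕ) ≤ q then f t else 0) =
      f q + ∑ t, if t < q then f t else 0 := by
    intro f q
    have : f q = ∑ t, if t = q then f t else 0 := by simp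
    rw [this, ← Finset.sum_add_distrib]
    refine Finset.sum_congr rfl fun t _ => ?_
    rcases lt_trichotomy t q with h | rfl | h
    · simp [h, h.ne, Fin.le_def.1 h.le]
    · simp
    · simp [h.not_gt, h.ne', h]
  funext q
  induction q using WellFoundedLT.induction with
  | ind q ih =>
    have h1 := h q
    rw [key, key] at h1
    have h2 : ∑ t, (if t < q then f t else 0) = ∑ t, if t < q then g t else 0 :=
      Finset.sum_congr rfl fun t _ => by
        by_cases ht : t < q
        · simp [ht, ih t ht]
        · simp [ht]
    omega

/-- Two lists of operators move the position at which `c` stands at first by the same amount. -/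
def sameMotion (l l' : List (ℕ × ℕ)) (c : ℕ) : Bool :=
  Nat.beq (finalLetter l c) (finalLetter l' c) &&
  Nat.beq (upTurns l c + downTurns l' c) (upTurns l' c + downTurns l c)

theorem sameMotion_of_run {n : ℕ} {k : Fin (n - 1)} {p : Perm (Fin n)} {l l' : List (Op n)}
    (h : Run k p l) (h' : Run k p l') (he : runExp p l = runExp p l')
    (hp : runPerm l = runPerm l') (c : Fin n) :
    sameMotion (l.map code) (l'.map code) c = true := by
  rw [sameMotion, Bool.and_eq_true, Nat.beq_eq, Nat.beq_eq]
  refine ⟨by rw [finalLetter_code, finalLetter_code, hp], ?_⟩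
  -- Equal exponents give equal prefix sums of net turns over the positions. Down turns are moved to
  -- the other side to avoid subtraction in `ℕ`.
  have key := eq_of_prefix_sums_eq
    (fun q => upTurns (l.map code) (p.symm q) + downTurns (l'.map code) (p.symm q))
    (fun q => upTurns (l'.map code) (p.symm q) + downTurns (l.map code) (p.symm q)) (fun s => by
      have e1 := turns_eq l p h s
      have e2 := turns_eq l' p h' s
      rw [← he] at e2
      have conv : ∀ f : Fin n → ℕ, ∑ q : Fin n, (if (q : ℕ) ≤ s then f (p.symm q) else 0) =
          ∑ c, if (p c : ℕ) ≤ s then f c else 0 := fun f => by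
        rw [← Equiv.sum_comp p]
        simp
      rw [conv fun c => upTurns (l.map code) c + downTurns (l'.map code) c,
        conv fun c => upTurns (l'.map code) c + downTurns (l.map code) c]
      have add : ∀ f g : Fin n → ℕ, ∑ c, (if (p c : ℕ) ≤ s then f c + g c else 0) =
          ∑ c, (if (p c : ℕ) ≤ s then f c else 0) + ∑ c, (if (p c : ℕ) ≤ s then g c else 0) := by
        intro f g
        rw [← Finset.sum_add_distrib]
        refine Finset.sum_congr rfl fun c _ => ?_
        split_ifs <;> rfl
      rw [add, add]
      omega)
  simpa using congrFun key (p c)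

/-! ### The finite check on at most six letters -/

/-- Three operators, the one acting first standing first. -/
abbrev Triple : Type := (ℕ × ℕ) × (ℕ × ℕ) × (ℕ × ℕ)

/-- The operators `o` and `o'` have no letter in common. -/
def disjointOps (o o' : ℕ × ℕ) : Bool :=
  !(Nat.beq o.1 o'.1) && !(Nat.beq o.1 o'.2) && !(Nat.beq o.2 o'.1) && !(Nat.beq o.2 o'.2)

/-- Equality of operators. -/
def sameOp (o o' : ℕ × ℕ) : Bool := Nat.beq o.1 o'.1 && Nat.beq o.2 o'.2

/-- The Boolean version of `Cyc`. -/
def cyc (a x b : ℕ) : Bool :=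
  (Nat.blt a x && Nat.blt x b) || (Nat.blt b a && (Nat.blt a x || Nat.blt x b))

/-- The operator `o'` may act directly after `o`. -/
def admissible (o o' : ℕ × ℕ) : Bool :=
  !(Nat.beq o'.1 o.1) && !(Nat.beq o'.2 o.2) &&
  bif Nat.beq o'.1 o.2 then Nat.beq o'.2 o.1 || !cyc o.1 o'.2 o.2
  else bif Nat.beq o'.2 o.1 then !cyc o.1 o'.1 o.2
  else bif cyc o.1 o'.1 o.2 then cyc o.1 o'.2 o.2 else !cyc o.1 o'.2 o.2

/-- Necessary conditions for three operators not to act as zero. -/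
def admissibleTriple (x : Triple) : Bool :=
  admissible x.1 x.2.1 && (admissible x.2.1 x.2.2 &&
  (!(disjointOps x.1 x.2.1 || disjointOps x.2.1 x.2.2) || admissible x.1 x.2.2) &&
  (!(sameOp x.1 x.2.2) || sameOp x.2.1 (x.1.2, x.1.1)))

/-- The pair of `v_{db} v_{bc} v_{ab}` and `v_{ab} v_{da} v_{ac}` for a cyclic order
`a < b < c ≤ d < a`. -/
def outerFamily (x y : Triple) : Bool :=
  Nat.beq x.2.1.1 x.1.2 && Nat.beq x.2.2.2 x.1.2 && sameOp y.1 (x.1.1, x.2.1.2) &&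
  sameOp y.2.1 (x.2.2.1, x.1.1) && sameOp y.2.2 x.1 && cyc x.1.1 x.1.2 x.2.1.2 &&
  (Nat.beq x.2.2.1 x.2.1.2 || cyc x.2.1.2 x.2.2.1 x.1.1)

/-- The pair of `v_{ca} v_{bc} v_{cd}` and `v_{cd} v_{da} v_{bd}` for a cyclic order
`a ≤ b < c < d < a`. -/
def innerFamily (x y : Triple) : Bool :=
  Nat.beq x.2.1.2 x.1.1 && Nat.beq x.2.2.1 x.1.1 && sameOp y.1 (x.2.1.1, x.1.2) &&
  sameOp y.2.1 (x.1.2, x.2.2.2) && sameOp y.2.2 x.1 && cyc x.2.1.1 x.1.1 x.1.2 &&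
  (Nat.beq x.2.2.2 x.2.1.1 || cyc x.1.2 x.2.2.2 x.2.1.1)

/-- Equality of triples. -/
def sameTriple (x : Triple) (o₁ o₂ o₃ : ℕ × ℕ) : Bool :=
  sameOp x.1 o₁ && sameOp x.2.1 o₂ && sameOp x.2.2 o₃

/-- The triple `y` arises from `x` by exchanging neighbouring operators with disjoint letters. -/
def rearranged (x y : Triple) : Bool :=
  sameTriple y x.1 x.2.1 x.2.2 ||
  (disjointOps x.1 x.2.1 && (sameTriple y x.2.1 x.1 x.2.2 ||
    (disjointOps x.1 x.2.2 && sameTriple y x.2.1 x.2.2 x.1))) ||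
  (disjointOps x.2.1 x.2.2 && (sameTriple y x.1 x.2.2 x.2.1 ||
    (disjointOps x.1 x.2.2 && (sameTriple y x.2.2 x.1 x.2.1 ||
    (disjointOps x.1 x.2.1 && sameTriple y x.2.2 x.2.1 x.1)))))

/-- The possible relations between two triples with the same motion. -/
def related (x y : Triple) : Bool :=
  rearranged x y || outerFamily x y || outerFamily y x || innerFamily x y || innerFamily y x

/-- A triple as a list. -/
def Triple.toList (x : Triple) : List (ℕ × ℕ) := [x.1, x.2.1, x.2.2]

/-- The letters of a triple. -/
def Triple.letters (x : Triple) : List ℕ :=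
  [x.1.1, x.1.2, x.2.1.1, x.2.1.2, x.2.2.1, x.2.2.2]

/-- `List.all` in a form on which the kernel computes quickly. -/
def allRec {α : Type} (l : List α) (p : α → Bool) : Bool :=
  List.rec (motive := fun _ => Bool) true
    (fun a _ ih => Bool.rec (motive := fun _ => Bool) false ih (p a)) l

theorem allRec_iff {α : Type} {l : List α} {p : α → Bool} :
    allRec l p = true ↔ ∀ a ∈ l, p a = true := by
  induction l with
  | nil => simp [allRec]
  | cons a l ih =>
    have : allRec (a :: l) p = Bool.rec (motive := fun _ => Bool) false (allRec l p) (p a) := rfl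
    rw [this, List.forall_mem_cons, ← ih]
    cases p a <;> simp

/-- The operators on the letters `0, …, m - 1`. -/
def opPairs (m : ℕ) : List (ℕ × ℕ) :=
  (List.range m).flatMap fun a => ((List.range m).filter fun b => !(Nat.beq a b)).map fun b => (a, b)

/-- The admissible triples with the letters `0, …, m - 1`. -/
def admissibleTriples (m : ℕ) : List Triple :=
  (opPairs m).flatMap fun o₁ => ((opPairs m).filter fun o₂ => admissible o₁ o₂).flatMap fun o₂ =>
    ((opPairs m).filter fun o₃ => admissibleTriple (o₁, o₂, o₃) &&
      allRec (List.range m) fun c => (Triple.letters (o₁, o₂, o₃)).any fun c' => Nat.beq c c').map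
      fun o₃ => (o₁, o₂, o₃)

/-- In an admissible triple with the letters `0, …, m - 1` all letters move, and two of them with the
same motion are related. -/
def motionCheck (m : ℕ) : Bool :=
  allRec (admissibleTriples m) fun x =>
    (allRec (List.range m) fun c => !(sameMotion x.toList [] c)) &&
    allRec (admissibleTriples m) fun y =>
      !(allRec (List.range m) fun c => sameMotion x.toList y.toList c) || related x y

-- An exhaustive computation. For its sake the functions above are built from `List.rec`, `Nat.beq`
-- and `Nat.blt`, which the kernel evaluates efficiently.
set_option maxRecDepth 100000 in
theorem motionCheck_eq_true {m : ℕ} (h2 : 2 ≤ m) (h6 : m ≤ 6) : motionCheck m = true := by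
  interval_cases m <;> decide +kernel

theorem beq_eq_false_iff {a b : ℕ} : Nat.beq a b = false ↔ a ≠ b := by
  rw [← Bool.not_eq_true, Nat.beq_eq]

theorem mem_opPairs {m : ℕ} {o : ℕ × ℕ} (h₁ : o.1 < m) (h₂ : o.2 < m) (h : o.1 ≠ o.2) :
    o ∈ opPairs m := by
  simp only [opPairs, List.mem_flatMap, List.mem_map, List.mem_filter, List.mem_range,
    Bool.not_eq_true', beq_eq_false_iff]
  exact ⟨o.1, h₁, o.2, ⟨h₂, h⟩, rfl⟩

/-- The operators of a triple are genuine. -/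
def Triple.Proper (x : Triple) : Prop := x.1.1 ≠ x.1.2 ∧ x.2.1.1 ≠ x.2.1.2 ∧ x.2.2.1 ≠ x.2.2.2

theorem mem_admissibleTriples {m : ℕ} {x : Triple} (hx : x.Proper)
    (ha : admissibleTriple x = true) (hl : ∀ c, c ∈ x.letters ↔ c < m) :
    x ∈ admissibleTriples m := by
  have hlt : ∀ c ∈ x.letters, c < m := fun c hc => (hl c).1 hc
  simp only [Triple.letters, List.forall_mem_cons] at hlt
  obtain ⟨h1, h2, h3, h4, h5, h6, -⟩ := hlt
  obtain ⟨n1, n2, n3⟩ := hx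
  simp only [admissibleTriples, List.mem_flatMap, List.mem_filter, List.mem_map, Bool.and_eq_true,
    allRec_iff, List.mem_range, List.any_eq_true]
  refine ⟨x.1, mem_opPairs h1 h2 n1, x.2.1, ⟨mem_opPairs h3 h4 n2, ?_⟩, x.2.2,
    ⟨mem_opPairs h5 h6 n3, ha, fun c hc => ⟨c, (hl c).2 hc, ?_⟩⟩, rfl⟩
  · simp only [admissibleTriple, Bool.and_eq_true] at ha
    exact ha.1
  · simp

/-! ### Reduction of arbitrary letters to an initial segment -/

/-- Replacing the letters of an operator. -/
def mapOp (e : ℕ → ℕ) (o : ℕ × ℕ) : ℕ × ℕ := (e o.1, e o.2)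

/-- Replacing the letters of a triple. -/
def Triple.map (e : ℕ → ℕ) (x : Triple) : Triple := (mapOp e x.1, mapOp e x.2.1, mapOp e x.2.2)

section StrictMono

variable {e : ℕ → ℕ}

theorem beq_map (he : StrictMono e) (a b : ℕ) : Nat.beq (e a) (e b) = Nat.beq a b := by
  rw [Bool.eq_iff_iff, Nat.beq_eq, Nat.beq_eq, he.injective.eq_iff]

theorem blt_map (he : StrictMono e) (a b : ℕ) : Nat.blt (e a) (e b) = Nat.blt a b := by
  rw [Bool.eq_iff_iff, Nat.blt_eq, Nat.blt_eq, he.lt_iff_lt]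

theorem admissibleTriple_map (he : StrictMono e) (x : Triple) :
    admissibleTriple (x.map e) = admissibleTriple x := by
  simp only [admissibleTriple, admissible, disjointOps, sameOp, cyc, Triple.map, mapOp, beq_map he,
    blt_map he]

theorem related_map (he : StrictMono e) (x y : Triple) :
    related (x.map e) (y.map e) = related x y := by
  simp only [related, rearranged, outerFamily, innerFamily, sameTriple, disjointOps, sameOp, cyc,
    Triple.map, mapOp, beq_map he, blt_map he]

theorem moveLetter_map (he : StrictMono e) (o : ℕ × ℕ) (c : ℕ) :
    moveLetter (mapOp e o) (e c) = e (moveLetter o c) := by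
  simp only [moveLetter, mapOp, beq_map he]
  cases Nat.beq c o.1 <;> cases Nat.beq c o.2 <;> rfl

theorem finalLetter_map (he : StrictMono e) (l : List (ℕ × ℕ)) (c : ℕ) :
    finalLetter (l.map (mapOp e)) (e c) = e (finalLetter l c) := by
  induction l generalizing c with
  | nil => rfl
  | cons o l ih => rw [List.map_cons, finalLetter_cons, finalLetter_cons, moveLetter_map he, ih]

theorem upTurns_map (he : StrictMono e) (l : List (ℕ × ℕ)) (c : ℕ) :
    upTurns (l.map (mapOp e)) (e c) = upTurns l c := by
  induction l generalizing c with
  | nil => rfl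
  | cons o l ih =>
    rw [List.map_cons, upTurns_cons, upTurns_cons, moveLetter_map he, ih, mapOp, beq_map he,
      blt_map he]

theorem downTurns_map (he : StrictMono e) (l : List (ℕ × ℕ)) (c : ℕ) :
    downTurns (l.map (mapOp e)) (e c) = downTurns l c := by
  induction l generalizing c with
  | nil => rfl
  | cons o l ih =>
    rw [List.map_cons, downTurns_cons, downTurns_cons, moveLetter_map he, ih, mapOp, beq_map he,
      blt_map he]

theorem sameMotion_map (he : StrictMono e) (l l' : List (ℕ × ℕ)) (c : ℕ) :
    sameMotion (l.map (mapOp e)) (l'.map (mapOp e)) (e c) = sameMotion l l' c := by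
  simp only [sameMotion, finalLetter_map he, upTurns_map he, downTurns_map he, beq_map he]

theorem map_letters (x : Triple) : (x.map e).letters = x.letters.map e := rfl

theorem map_toList (x : Triple) : (x.map e).toList = x.toList.map (mapOp e) := rfl

end StrictMono

/-- A finite set of natural numbers is an initial segment, up to a strictly increasing map. -/
theorem exists_strictMono_image (S : Finset ℕ) :
    ∃ e r : ℕ → ℕ, StrictMono e ∧ (∀ c ∈ S, e (r c) = c) ∧ ∀ i, i < S.card ↔ e i ∈ S := by
  classical
  -- Adding to `S` all numbers above it makes the set infinite, so that `Nat.nth P` is strictly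
  -- increasing on all of `ℕ`, while its first `S.card` values are still the elements of `S`.
  set P : ℕ → Prop := fun c => c ∈ S ∨ ∀ s ∈ S, s < c with hP
  have hinf : {c | P c}.Infinite := by
    refine Set.infinite_of_not_bddAbove fun ⟨B, hB⟩ => ?_
    have := hB (show P (S.sup id + B + 1) from Or.inr fun s hs => by
      have := Finset.le_sup (f := id) hs
      simp only [id] at this
      omega)
    omega
  refine ⟨Nat.nth P, Nat.count P, Nat.nth_strictMono hinf, fun c hc => Nat.nth_count (Or.inl hc),
    fun i => ?_⟩
  have hi : Nat.count P (Nat.nth P i) = i := Nat.count_nth_of_infinite hinf i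
  rw [Nat.count_eq_card_filter_range] at hi
  constructor
  · intro h
    refine (Nat.nth_mem_of_infinite hinf i).resolve_right fun H => ?_
    have : S.card ≤ i := by
      rw [← hi]
      refine Finset.card_le_card fun s hs => ?_
      simp only [Finset.mem_filter, Finset.mem_range]
      exact ⟨H s hs, Or.inl hs⟩
    omega
  · intro h
    rw [← hi]
    refine Finset.card_lt_card ⟨fun c hc => ?_, fun H => ?_⟩
    · simp only [Finset.mem_filter, Finset.mem_range] at hc
      exact hc.2.resolve_right fun H => by have := H _ h; omega
    · have := H h
      simp at this

theorem card_letters {x : Triple} (hx : x.Proper) :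
    2 ≤ x.letters.toFinset.card ∧ x.letters.toFinset.card ≤ 6 := by
  refine ⟨?_, List.toFinset_card_le _⟩
  have : ({x.1.1, x.1.2} : Finset ℕ) ⊆ x.letters.toFinset := by
    intro c
    simp only [Finset.mem_insert, Finset.mem_singleton, Triple.letters, List.mem_toFinset,
      List.mem_cons]
    tauto
  calc 2 = ({x.1.1, x.1.2} : Finset ℕ).card := (Finset.card_pair hx.1).symm
    _ ≤ _ := Finset.card_le_card this

theorem exists_map_mem_admissibleTriples {S : Finset ℕ} {e r : ℕ → ℕ} (he : StrictMono e)
    (her : ∀ c ∈ S, e (r c) = c) (hS : ∀ i, i < S.card ↔ e i ∈ S) {x : Triple} (hx : x.Proper)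
    (ha : admissibleTriple x = true) (hl : x.letters.toFinset = S) :
    ∃ x' ∈ admissibleTriples S.card, x'.map e = x := by
  have hmem : ∀ c ∈ x.letters, e (r c) = c := fun c hc => her c (by rw [← hl]; simpa using hc)
  have hmap : (x.map r).map e = x := by
    simp only [Triple.letters, List.forall_mem_cons] at hmem
    obtain ⟨h1, h2, h3, h4, h5, h6, -⟩ := hmem
    simp only [Triple.map, mapOp, h1, h2, h3, h4, h5, h6]
  refine ⟨x.map r, mem_admissibleTriples ?_ ?_ fun c => ?_, hmap⟩
  · rw [← hmap] at hx
    exact ⟨fun h => hx.1 (congrArg e h), fun h => hx.2.1 (congrArg e h),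
      fun h => hx.2.2 (congrArg e h)⟩
  · rw [← admissibleTriple_map he, hmap, ha]
  · rw [hS, ← hl, List.mem_toFinset]
    conv_rhs => rw [← hmap, map_letters, List.mem_map_of_injective he.injective]

theorem sameMotion_nil_eq_false {x : Triple} (hx : x.Proper) (ha : admissibleTriple x = true) {c : ℕ}
    (hc : c ∈ x.letters) : sameMotion x.toList [] c = false := by
  obtain ⟨e, r, he, her, hS⟩ := exists_strictMono_image x.letters.toFinset
  obtain ⟨x', hx', rfl⟩ := exists_map_mem_admissibleTriples he her hS hx ha rfl
  have hcheck := motionCheck_eq_true (card_letters hx).1 (card_letters hx).2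
  simp only [motionCheck, allRec_iff, Bool.and_eq_true, List.mem_range] at hcheck
  obtain ⟨c', hc', rfl⟩ := List.mem_map.1 (map_letters x' ▸ hc)
  have := (hcheck x' hx').1 c' ((hS c').2 (by simpa using hc))
  rw [map_toList]
  have h := sameMotion_map he x'.toList [] c'
  rw [List.map_nil] at h
  rw [h]
  simpa using this

theorem sameMotion_right_congr {y : Triple} {l : List (ℕ × ℕ)} {c : ℕ} (hc : c ∉ y.letters) :
    sameMotion l y.toList c = sameMotion l [] c ∧ sameMotion y.toList l c = sameMotion [] l c := by
  have h : ∀ o : ℕ × ℕ, c ≠ o.1 → c ≠ o.2 → moveLetter o c = c := fun o h1 h2 => by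
    simp [moveLetter_eq, h1, h2]
  have hb : ∀ a, c ≠ a → Nat.beq c a = false := fun a h => beq_eq_false_iff.2 h
  simp only [Triple.letters, List.mem_cons, List.not_mem_nil, or_false, not_or] at hc
  obtain ⟨h1, h2, h3, h4, h5, h6⟩ := hc
  have hf : finalLetter y.toList c = c := by
    simp only [Triple.toList, finalLetter_cons, finalLetter_nil, h _ h1 h2, h _ h3 h4, h _ h5 h6]
  have hu : upTurns y.toList c = 0 := by
    simp only [Triple.toList, upTurns_cons, upTurns_nil, h _ h1 h2, h _ h3 h4, h _ h5 h6, hb _ h1,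
      hb _ h3, hb _ h5, Bool.false_and, cond_false]
  have hd : downTurns y.toList c = 0 := by
    simp only [Triple.toList, downTurns_cons, downTurns_nil, h _ h1 h2, h _ h3 h4, h _ h5 h6,
      hb _ h2, hb _ h4, hb _ h6, Bool.false_and, cond_false]
  simp only [sameMotion, hf, hu, hd, finalLetter_nil, upTurns_nil, downTurns_nil, and_self]

theorem sameMotion_comm (l l' : List (ℕ × ℕ)) (c : ℕ) : sameMotion l l' c = sameMotion l' l c := by
  rw [Bool.eq_iff_iff]
  simp only [sameMotion, Bool.and_eq_true, Nat.beq_eq]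
  exact and_congr eq_comm eq_comm

/-- A letter of `x` missing from `y` would keep its place under `y`, whereas by the finite check
every letter of an admissible triple has non-trivial motion. Hence triples with the same motion have
the same letters and can be compressed by one common map. -/
theorem letters_subset_of_sameMotion {x y : Triple} (hx : x.Proper) (ha : admissibleTriple x = true)
    (h : ∀ c ∈ x.letters, sameMotion x.toList y.toList c = true) :
    x.letters.toFinset ⊆ y.letters.toFinset := by
  intro c hc
  rw [List.mem_toFinset] at hc ⊢
  by_contra hc'
  have h1 := h c hc
  rw [(sameMotion_right_congr hc').1, sameMotion_nil_eq_false hx ha hc] at h1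
  simp at h1

/-- Two admissible triples with the same motion are related. -/
theorem related_of_sameMotion {x y : Triple} (hx : x.Proper) (hy : y.Proper)
    (hax : admissibleTriple x = true) (hay : admissibleTriple y = true)
    (hxy : ∀ c ∈ x.letters, sameMotion x.toList y.toList c = true)
    (hyx : ∀ c ∈ y.letters, sameMotion x.toList y.toList c = true) : related x y = true := by
  have hsub := letters_subset_of_sameMotion hx hax hxy
  have hsub' := letters_subset_of_sameMotion hy hay fun c hc => by
    rw [sameMotion_comm, hyx c hc]
  obtain ⟨e, r, he, her, hS⟩ := exists_strictMono_image x.letters.toFinset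
  have hcheck := motionCheck_eq_true (card_letters hx).1 (card_letters hx).2
  obtain ⟨x', hx', hxe⟩ := exists_map_mem_admissibleTriples he her hS hx hax rfl
  obtain ⟨y', hy', hye⟩ := exists_map_mem_admissibleTriples he her hS hy hay
    (hsub'.antisymm hsub)
  simp only [motionCheck, allRec_iff, Bool.and_eq_true, List.mem_range] at hcheck
  have h := (hcheck x' hx').2 y' hy'
  rw [Bool.or_eq_true, Bool.not_eq_true'] at h
  rw [← hxe, ← hye, related_map he]
  refine h.resolve_left fun H => ?_
  have : (allRec (List.range x.letters.toFinset.card) fun c => sameMotion x'.toList y'.toList c) =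
      true := by
    rw [allRec_iff]
    intro c hc
    rw [← sameMotion_map he, ← map_toList, ← map_toList, hxe, hye]
    exact hxy _ (by simpa using (hS c).1 (by simpa using hc))
  rw [H] at this
  simp at this

/-! ### Non-zero words are admissible; commutations -/

theorem cyc_iff {a x b : ℕ} : cyc a x b = true ↔ Cyc a x b := by
  simp only [cyc, Bool.or_eq_true, Bool.and_eq_true, Nat.blt_eq, Cyc]

theorem disjointOps_iff {o o' : ℕ × ℕ} :
    disjointOps o o' = true ↔ o.1 ≠ o'.1 ∧ o.1 ≠ o'.2 ∧ o.2 ≠ o'.1 ∧ o.2 ≠ o'.2 := by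
  simp only [disjointOps, Bool.and_eq_true, Bool.not_eq_true', beq_eq_false_iff, and_assoc]

theorem sameOp_iff {o o' : ℕ × ℕ} : sameOp o o' = true ↔ o = o' := by
  simp only [sameOp, Bool.and_eq_true, Nat.beq_eq, Prod.ext_iff]

theorem admissible_iff {o o' : ℕ × ℕ} : admissible o o' = true ↔
    o'.1 ≠ o.1 ∧ o'.2 ≠ o.2 ∧ (o'.1 = o.2 → o'.2 ≠ o.1 → ¬ Cyc o.1 o'.2 o.2) ∧
    (o'.2 = o.1 → o'.1 ≠ o.2 → ¬ Cyc o.1 o'.1 o.2) ∧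
    (o'.1 ≠ o.2 → o'.2 ≠ o.1 → (Cyc o.1 o'.1 o.2 ↔ Cyc o.1 o'.2 o.2)) := by
  have h1 : cyc o.1 o'.1 o.2 = decide (Cyc o.1 o'.1 o.2) := by
    rw [Bool.eq_iff_iff, cyc_iff, decide_eq_true_iff]
  have h2 : cyc o.1 o'.2 o.2 = decide (Cyc o.1 o'.2 o.2) := by
    rw [Bool.eq_iff_iff, cyc_iff, decide_eq_true_iff]
  simp only [admissible, Bool.and_eq_true, Bool.not_eq_true', beq_eq_false_iff, cond_eq_ite,
    Nat.beq_eq, h1, h2]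
  by_cases e1 : o'.1 = o.2 <;> by_cases e2 : o'.2 = o.1 <;> by_cases c1 : Cyc o.1 o'.1 o.2 <;>
    by_cases c2 : Cyc o.1 o'.2 o.2 <;> simp [e1, e2, c1, c2]

theorem admissible_of_moves {n : ℕ} {k : Fin (n - 1)} {p : Perm (Fin n)} {o o' : Op n}
    (h : Moves k p o.1.1 o.1.2) (h' : Moves k (p * swap o.1.1 o.1.2) o'.1.1 o'.1.2) :
    admissible (code o) (code o') = true := by
  have := Moves.ok o.2 o'.2 h h'
  rw [admissible_iff]
  simpa only [code, ne_eq, Fin.val_inj] using this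

theorem moves_comm {n : ℕ} {k : Fin (n - 1)} {p : Perm (Fin n)} {o o' : Op n}
    (hd : disjointOps (code o) (code o') = true)
    (h : Moves k p o.1.1 o.1.2) (h' : Moves k (p * swap o.1.1 o.1.2) o'.1.1 o'.1.2) :
    Moves k p o'.1.1 o'.1.2 ∧ Moves k (p * swap o'.1.1 o'.1.2) o.1.1 o.1.2 := by
  have ha := Moves.ok o.2 o'.2 h h'
  simp only [disjointOps_iff, code, ne_eq, Fin.val_inj] at hd
  obtain ⟨h1, h2, h3, h4⟩ := hd
  exact Moves.comm (Ne.symm h1) (Ne.symm h3) (Ne.symm h2) (Ne.symm h4) o.2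
    (ha.2.2.2.2 (Ne.symm h3) (Ne.symm h2)) h h'

theorem disjointOps_comm {o o' : ℕ × ℕ} (h : disjointOps o o' = true) :
    disjointOps o' o = true := by
  rw [disjointOps_iff] at *
  tauto

theorem swap_comm_of_disjointOps {n : ℕ} {o o' : Op n}
    (hd : disjointOps (code o) (code o') = true) :
    swap o.1.1 o.1.2 * swap o'.1.1 o'.1.2 = swap o'.1.1 o'.1.2 * swap o.1.1 o.1.2 := by
  simp only [disjointOps_iff, code, ne_eq, Fin.val_inj] at hd
  obtain ⟨h1, h2, h3, h4⟩ := hd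
  rw [mul_swap_eq_swap_mul, swap_apply_of_ne_of_ne (Ne.symm h1) (Ne.symm h3),
    swap_apply_of_ne_of_ne (Ne.symm h2) (Ne.symm h4)]

theorem wrapExp_mul_swap {n : ℕ} {o o' : Op n} (p : Perm (Fin n))
    (hd : disjointOps (code o) (code o') = true) :
    wrapExp (p * swap o.1.1 o.1.2) o'.1.1 o'.1.2 = wrapExp p o'.1.1 o'.1.2 := by
  simp only [disjointOps_iff, code, ne_eq, Fin.val_inj] at hd
  obtain ⟨h1, h2, h3, h4⟩ := hd
  rw [wrapExp, wrapExp, Perm.mul_apply, Perm.mul_apply,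
    swap_apply_of_ne_of_ne (Ne.symm h1) (Ne.symm h3),
    swap_apply_of_ne_of_ne (Ne.symm h2) (Ne.symm h4)]

theorem ops_of_mul_of {n : ℕ} (o o' : Op n) :
    ops (FreeMonoid.of o' * FreeMonoid.of o) = [o, o'] := by
  simp [ops]

/-- Operators with disjoint letters commute. -/
theorem equivalent_of_disjointOps {n : ℕ} {o o' : Op n}
    (hd : disjointOps (code o) (code o') = true) :
    Equivalent ((FreeMonoid.of o' * FreeMonoid.of o : Word n) : WithZero (Word n))
      (FreeMonoid.of o * FreeMonoid.of o' : Word n) := by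
  rw [equivalent_iff]
  intro k p
  simp only [ops_of_mul_of, Run, runExp, runPerm, and_true, add_zero, one_mul]
  refine ⟨⟨fun h => moves_comm hd h.1 h.2, fun h => moves_comm (disjointOps_comm hd) h.1 h.2⟩,
    fun _ => ⟨?_, (swap_comm_of_disjointOps hd).symm⟩⟩
  rw [wrapExp_mul_swap p hd, wrapExp_mul_swap p (disjointOps_comm hd), add_comm]

/-- The composition of three operators, given in the order in which they act. -/
def word {n : ℕ} (o₁ o₂ o₃ : Op n) : Word n :=
  FreeMonoid.of o₃ * FreeMonoid.of o₂ * FreeMonoid.of o₁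

theorem ops_word {n : ℕ} (o₁ o₂ o₃ : Op n) : ops (word o₁ o₂ o₃) = [o₁, o₂, o₃] := by
  simp [ops, word]

theorem exists_eq_word {n : ℕ} {w : Word n} (h : w.length = 3) :
    ∃ o₁ o₂ o₃, w = word o₁ o₂ o₃ := by
  rw [← length_ops, List.length_eq_three] at h
  obtain ⟨a, b, c, h⟩ := h
  exact ⟨a, b, c, ops_injective (by rw [h, ops_word])⟩

/-- The triple of three operators. -/
def triple {n : ℕ} (o₁ o₂ o₃ : Op n) : Triple := (code o₁, code o₂, code o₃)

theorem proper_triple {n : ℕ} (o₁ o₂ o₃ : Op n) : (triple o₁ o₂ o₃).Proper := by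
  refine ⟨fun h => o₁.2 ?_, fun h => o₂.2 ?_, fun h => o₃.2 ?_⟩ <;> exact Fin.ext h

/-- Neighbours satisfy `Moves.ok`. If two neighbours are disjoint, commuting them makes the outer
two operators adjacent, so these must be admissible as well. -/
theorem admissibleTriple_of_run {n : ℕ} {k : Fin (n - 1)} {p : Perm (Fin n)} {o₁ o₂ o₃ : Op n}
    (h : Run k p [o₁, o₂, o₃]) : admissibleTriple (triple o₁ o₂ o₃) = true := by
  obtain ⟨h1, h2, h3, -⟩ := h
  have a12 := admissible_of_moves h1 h2
  simp only [admissibleTriple, triple, Bool.and_eq_true, Bool.or_eq_true, Bool.not_eq_true']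
  refine ⟨a12, ⟨admissible_of_moves h2 h3, ?_⟩, ?_⟩
  · rw [or_iff_not_imp_left, Bool.not_eq_false, Bool.or_eq_true]
    rintro (hd | hd)
    · have := moves_comm hd h1 h2
      rw [mul_assoc, swap_comm_of_disjointOps hd, ← mul_assoc] at h3
      exact admissible_of_moves this.2 h3
    · exact admissible_of_moves h1 (moves_comm hd h2 h3).1
  · rw [or_iff_not_imp_left, Bool.not_eq_false, sameOp_iff, sameOp_iff]
    intro e
    -- After `v_{ab}` the letter `a` is right of the cut and `b` left of it. To allow `v_{ab}`
    -- again, the single middle step has to bring both back, so it is `v_{ba}`.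
    have e := code_injective e
    subst e
    obtain ⟨n1, n2, -⟩ := Moves.ok o₁.2 o₂.2 h1 h2
    have s1 := h1.1
    have s2 := h1.2.1
    have s3 := h3.1
    have s4 := h3.2.1
    rw [Perm.mul_apply, Perm.mul_apply] at s3 s4
    have e1 : o₂.1.2 = o₁.1.1 := by
      by_contra hne
      rw [swap_apply_of_ne_of_ne (Ne.symm n1) (Ne.symm hne), swap_apply_left] at s3
      omega
    have e2 : o₂.1.1 = o₁.1.2 := by
      by_contra hne
      rw [swap_apply_of_ne_of_ne (Ne.symm hne) (Ne.symm n2), swap_apply_right] at s4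
      omega
    simp only [code, e1, e2]

/-- Equivalent non-zero compositions of three operators are related. -/
theorem related_of_equivalent {n : ℕ} {o₁ o₂ o₃ o₁' o₂' o₃' : Op n}
    (h : Equivalent (word o₁ o₂ o₃ : WithZero (Word n)) (word o₁' o₂' o₃'))
    (h0 : ¬ Equivalent (word o₁ o₂ o₃ : WithZero (Word n)) 0) :
    related (triple o₁ o₂ o₃) (triple o₁' o₂' o₃') = true := by
  obtain ⟨k, p, hr⟩ := not_equivalent_zero_iff.1 h0
  obtain ⟨h1, h2⟩ := equivalent_iff.1 h k p
  have hr' := h1.1 hr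
  obtain ⟨he, hp⟩ := h2 hr
  rw [ops_word] at hr he hp
  rw [ops_word] at hr' he hp
  have hm : ∀ c : Fin n, sameMotion (triple o₁ o₂ o₃).toList (triple o₁' o₂' o₃').toList c = true :=
    sameMotion_of_run hr hr' he hp
  have hl : ∀ (a b c : Op n), ∀ x ∈ (triple a b c).letters, x < n := by
    intro a b c x hx
    simp only [triple, code, Triple.letters, List.mem_cons, List.not_mem_nil, or_false] at hx
    omega
  exact related_of_sameMotion (proper_triple _ _ _) (proper_triple _ _ _)
    (admissibleTriple_of_run hr) (admissibleTriple_of_run hr')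
    (fun c hc => hm ⟨c, hl _ _ _ c hc⟩) (fun c hc => hm ⟨c, hl _ _ _ c hc⟩)

theorem sameTriple_triple {n : ℕ} {o₁ o₂ o₃ o₁' o₂' o₃' : Op n}
    (h : sameTriple (triple o₁ o₂ o₃) (code o₁') (code o₂') (code o₃') = true) :
    word o₁ o₂ o₃ = word o₁' o₂' o₃' := by
  simp only [sameTriple, triple, Bool.and_eq_true, sameOp_iff, code_injective.eq_iff] at h
  rw [h.1.1, h.1.2, h.2]

theorem lowerCon_of_disjointOps {n : ℕ} {o o' : Op n}
    (hd : disjointOps (code o) (code o') = true) :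
    lowerCon n 3 ((FreeMonoid.of o' * FreeMonoid.of o : Word n) : WithZero (Word n))
      (FreeMonoid.of o * FreeMonoid.of o' : Word n) := by
  refine ConGen.Rel.of _ _ ⟨equivalent_of_disjointOps hd, ?_⟩
  change max (FreeMonoid.length (FreeMonoid.of o' * FreeMonoid.of o))
    (FreeMonoid.length (FreeMonoid.of o * FreeMonoid.of o')) < 3
  simp

theorem lowerCon_swap_first {n : ℕ} {o₁ o₂ : Op n} (o₃ : Op n)
    (hd : disjointOps (code o₁) (code o₂) = true) :
    lowerCon n 3 (word o₁ o₂ o₃) (word o₂ o₁ o₃) := by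
  have := (lowerCon n 3).mul ((lowerCon n 3).refl ((FreeMonoid.of o₃ : Word n) : WithZero (Word n)))
    (lowerCon_of_disjointOps hd)
  simpa only [word, mul_assoc, WithZero.coe_mul] using this

theorem lowerCon_swap_last {n : ℕ} (o₁ : Op n) {o₂ o₃ : Op n}
    (hd : disjointOps (code o₂) (code o₃) = true) :
    lowerCon n 3 (word o₁ o₂ o₃) (word o₁ o₃ o₂) :=
  (lowerCon n 3).mul (lowerCon_of_disjointOps hd)
    ((lowerCon n 3).refl ((FreeMonoid.of o₁ : Word n) : WithZero (Word n)))

theorem lowerCon_of_rearranged {n : ℕ} {o₁ o₂ o₃ o₁' o₂' o₃' : Op n}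
    (h : rearranged (triple o₁ o₂ o₃) (triple o₁' o₂' o₃') = true) :
    lowerCon n 3 (word o₁ o₂ o₃) (word o₁' o₂' o₃') := by
  simp only [rearranged, Bool.or_eq_true, Bool.and_eq_true] at h
  rcases h with (h | ⟨d12, h | ⟨d13, h⟩⟩) | ⟨d23, h | ⟨d13, h | ⟨d12, h⟩⟩⟩ <;>
    rw [sameTriple_triple h]
  · exact (lowerCon n 3).refl _
  · exact lowerCon_swap_first o₃ d12
  · exact (lowerCon n 3).trans (lowerCon_swap_first o₃ d12) (lowerCon_swap_last o₂ d13)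
  · exact lowerCon_swap_last o₁ d23
  · exact (lowerCon n 3).trans (lowerCon_swap_last o₁ d23) (lowerCon_swap_first o₂ d13)
  · exact (lowerCon n 3).trans ((lowerCon n 3).trans (lowerCon_swap_last o₁ d23)
      (lowerCon_swap_first o₂ d13)) (lowerCon_swap_last o₃ d12)

/-! ### The fourteen families as two cyclic ones -/

theorem Cyc.ne_left {a x b : ℕ} (h : Cyc a x b) : a ≠ x := by unfold Cyc at h; omega

theorem Cyc.ne_right {a x b : ℕ} (h : Cyc a x b) : x ≠ b := by unfold Cyc at h; omega

/-- The operator `v_{ab}`. -/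
def op {n : ℕ} (a b : Fin n) (h : a ≠ b) : Op n := ⟨(a, b), h⟩

/-- The fourteen families, arranged into two cyclically symmetric ones. -/
inductive CyclicFamily {n : ℕ} : Word n → Word n → Prop
  | outer {a b c d : Fin n} (ab : a ≠ b) (ac : a ≠ c) (bc : b ≠ c) (ad : a ≠ d) (bd : b ≠ d)
      (h : Cyc a b c) (hd : d = c ∨ Cyc c d a) :
      CyclicFamily (word (op a b ab) (op b c bc) (op d b bd.symm))
        (word (op a c ac) (op d a ad.symm) (op a b ab))
  | inner {a b c d : Fin n} (bc : b ≠ c) (bd : b ≠ d) (cd : c ≠ d) (ac : a ≠ c) (ad : a ≠ d)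
      (h : Cyc b c d) (hd : a = b ∨ Cyc d a b) :
      CyclicFamily (word (op c d cd) (op b c bc) (op c a ac.symm))
        (word (op b d bd) (op d a ad.symm) (op c d cd))

theorem CyclicFamily.of_listed {n : ℕ} {x y : Word n} (h : Listed x y) : CyclicFamily x y := by
  cases h with
  | rel_i ab bc ac => exact .outer ab.ne ac.ne bc.ne ac.ne bc.ne (.inl ⟨ab, bc⟩) (.inl rfl)
  | rel_ii ab bc ac =>
    exact .outer bc.ne ab.ne' ac.ne' ab.ne' ac.ne' (by unfold Cyc; omega) (.inl rfl)
  | rel_iii ab bc ac =>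
    exact .outer ac.ne' bc.ne' ab.ne bc.ne' ab.ne (by unfold Cyc; omega) (.inl rfl)
  | rel_iv ab bc ac => exact .inner ab.ne ac.ne bc.ne ab.ne ac.ne (.inl ⟨ab, bc⟩) (.inl rfl)
  | rel_v ab bc ac =>
    exact .inner bc.ne ab.ne' ac.ne' bc.ne ab.ne' (by unfold Cyc; omega) (.inl rfl)
  | rel_vi ab bc ac =>
    exact .inner ac.ne' bc.ne' ab.ne ac.ne' bc.ne' (by unfold Cyc; omega) (.inl rfl)
  | rel_vii ab bc ac ad bd cd =>
    exact .outer ab.ne ac.ne bc.ne ad.ne bd.ne (by unfold Cyc; omega) (.inr (by unfold Cyc; omega))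
  | rel_viii ab bc ac ad bd cd =>
    exact .outer bc.ne bd.ne cd.ne ab.ne' ac.ne' (by unfold Cyc; omega)
      (.inr (by unfold Cyc; omega))
  | rel_ix ab bc ac ad bd cd =>
    exact .outer cd.ne ac.ne' ad.ne' bc.ne' bd.ne' (by unfold Cyc; omega)
      (.inr (by unfold Cyc; omega))
  | rel_x ab bc ac ad bd cd =>
    exact .outer ad.ne' bd.ne' ab.ne cd.ne' ac.ne (by unfold Cyc; omega)
      (.inr (by unfold Cyc; omega))
  | rel_xi ab bc ac ad bd cd =>
    exact .inner bc.ne bd.ne cd.ne ac.ne ad.ne (by unfold Cyc; omega) (.inr (by unfold Cyc; omega))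
  | rel_xii ab bc ac ad bd cd =>
    exact .inner cd.ne ac.ne' ad.ne' bd.ne ab.ne' (by unfold Cyc; omega)
      (.inr (by unfold Cyc; omega))
  | rel_xiii ab bc ac ad bd cd =>
    exact .inner ad.ne' bd.ne' ab.ne ac.ne' bc.ne' (by unfold Cyc; omega)
      (.inr (by unfold Cyc; omega))
  | rel_xiv ab bc ac ad bd cd =>
    exact .inner ab.ne ac.ne bc.ne bd.ne' cd.ne' (by unfold Cyc; omega)
      (.inr (by unfold Cyc; omega))

/-- A cyclic order is cut open at its smallest letter: three ways for three letters and four ways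
for four, in each of the two families. -/
theorem CyclicFamily.listed {n : ℕ} {x y : Word n} (h : CyclicFamily x y) : Listed x y := by
  cases h with
  | @outer a b c d ab ac bc ad bd h hd =>
    rcases hd with rfl | hd
    · have : (a < b ∧ b < d) ∨ (b < d ∧ d < a) ∨ (d < a ∧ a < b) := by unfold Cyc at h; omega
      rcases this with ⟨h1, h2⟩ | ⟨h1, h2⟩ | ⟨h1, h2⟩
      · exact .rel_i h1 h2 (h1.trans h2)
      · exact .rel_iii h1 h2 (h1.trans h2)
      · exact .rel_ii h1 h2 (h1.trans h2)
    · have : (a < b ∧ b < c ∧ c < d) ∨ (b < c ∧ c < d ∧ d < a) ∨ (c < d ∧ d < a ∧ a < b) ∨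
          (d < a ∧ a < b ∧ b < c) := by
        unfold Cyc at h hd; omega
      rcases this with ⟨h1, h2, h3⟩ | ⟨h1, h2, h3⟩ | ⟨h1, h2, h3⟩ | ⟨h1, h2, h3⟩
      · exact .rel_vii h1 h2 (h1.trans h2) (h1.trans (h2.trans h3)) (h2.trans h3) h3
      · exact .rel_x h1 h2 (h1.trans h2) (h1.trans (h2.trans h3)) (h2.trans h3) h3
      · exact .rel_ix h1 h2 (h1.trans h2) (h1.trans (h2.trans h3)) (h2.trans h3) h3
      · exact .rel_viii h1 h2 (h1.trans h2) (h1.trans (h2.trans h3)) (h2.trans h3) h3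
  | @inner a b c d bc bd cd ac ad h hd =>
    rcases hd with rfl | hd
    · have : (a < c ∧ c < d) ∨ (c < d ∧ d < a) ∨ (d < a ∧ a < c) := by unfold Cyc at h; omega
      rcases this with ⟨h1, h2⟩ | ⟨h1, h2⟩ | ⟨h1, h2⟩
      · exact .rel_iv h1 h2 (h1.trans h2)
      · exact .rel_vi h1 h2 (h1.trans h2)
      · exact .rel_v h1 h2 (h1.trans h2)
    · have : (a < b ∧ b < c ∧ c < d) ∨ (b < c ∧ c < d ∧ d < a) ∨ (c < d ∧ d < a ∧ a < b) ∨
          (d < a ∧ a < b ∧ b < c) := by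
        unfold Cyc at h hd; omega
      rcases this with ⟨h1, h2, h3⟩ | ⟨h1, h2, h3⟩ | ⟨h1, h2, h3⟩ | ⟨h1, h2, h3⟩
      · exact .rel_xi h1 h2 (h1.trans h2) (h1.trans (h2.trans h3)) (h2.trans h3) h3
      · exact .rel_xiv h1 h2 (h1.trans h2) (h1.trans (h2.trans h3)) (h2.trans h3) h3
      · exact .rel_xiii h1 h2 (h1.trans h2) (h1.trans (h2.trans h3)) (h2.trans h3) h3
      · exact .rel_xii h1 h2 (h1.trans h2) (h1.trans (h2.trans h3)) (h2.trans h3) h3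

theorem CyclicFamily.of_outerFamily {n : ℕ} {o₁ o₂ o₃ o₁' o₂' o₃' : Op n}
    (h : outerFamily (triple o₁ o₂ o₃) (triple o₁' o₂' o₃') = true) :
    CyclicFamily (word o₁ o₂ o₃) (word o₁' o₂' o₃') := by
  obtain ⟨⟨a, b⟩, ab⟩ := o₁
  obtain ⟨⟨b', c⟩, bc⟩ := o₂
  obtain ⟨⟨d, b''⟩, db⟩ := o₃
  obtain ⟨⟨_, _⟩, ac⟩ := o₁'
  obtain ⟨⟨_, _⟩, da⟩ := o₂'
  obtain ⟨⟨_, _⟩, _⟩ := o₃'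
  simp only [outerFamily, triple, code, Bool.and_eq_true, Bool.or_eq_true, Nat.beq_eq, sameOp_iff,
    cyc_iff, Prod.mk.injEq, Fin.val_inj] at h
  obtain ⟨⟨⟨⟨⟨⟨rfl, rfl⟩, rfl, rfl⟩, rfl, rfl⟩, rfl, rfl⟩, h⟩, hd⟩ := h
  exact .outer ab ac bc (Ne.symm da) (Ne.symm db) h hd

theorem CyclicFamily.of_innerFamily {n : ℕ} {o₁ o₂ o₃ o₁' o₂' o₃' : Op n}
    (h : innerFamily (triple o₁ o₂ o₃) (triple o₁' o₂' o₃') = true) :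
    CyclicFamily (word o₁ o₂ o₃) (word o₁' o₂' o₃') := by
  obtain ⟨⟨c, d⟩, cd⟩ := o₁
  obtain ⟨⟨b, c'⟩, bc⟩ := o₂
  obtain ⟨⟨c'', a⟩, ca⟩ := o₃
  obtain ⟨⟨_, _⟩, bd⟩ := o₁'
  obtain ⟨⟨_, _⟩, da⟩ := o₂'
  obtain ⟨⟨_, _⟩, _⟩ := o₃'
  simp only [innerFamily, triple, code, Bool.and_eq_true, Bool.or_eq_true, Nat.beq_eq, sameOp_iff,
    cyc_iff, Prod.mk.injEq, Fin.val_inj] at h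
  obtain ⟨⟨⟨⟨⟨⟨rfl, rfl⟩, rfl, rfl⟩, rfl, rfl⟩, rfl, rfl⟩, h⟩, hd⟩ := h
  exact .inner bc bd cd (Ne.symm ca) (Ne.symm da) h hd

theorem CyclicFamily.equivalent {n : ℕ} {x y : Word n} (h : CyclicFamily x y) :
    Equivalent (x : WithZero (Word n)) y := by
  rw [equivalent_iff]
  intro k p
  cases h with
  | @outer a b c d ab ac bc ad bd h hd =>
    simp only [ops_word, Run, runExp, runPerm, and_true, add_zero, one_mul, op]
    refine ⟨?_, fun H => ⟨wrapExp_outer h ac ad hd H.1 H.2.1 H.2.2, swap_prod_outer ab ac bc ad bd⟩⟩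
    rcases hd with rfl | hd
    · exact moves_outer_degenerate h ac
    · exact moves_outer h ac ad hd
  | @inner a b c d bc bd cd ac ad h hd =>
    simp only [ops_word, Run, runExp, runPerm, and_true, add_zero, one_mul, op]
    refine ⟨?_, fun H => ⟨wrapExp_inner h bd ad hd H.1 H.2.1 H.2.2, swap_prod_inner ac ad bc bd cd⟩⟩
    rcases hd with rfl | hd
    · exact moves_inner_degenerate h bd
    · exact moves_inner h bd ad hd

/-! ### The families are non-zero -/

/-- Any distinct letters can be put at the first positions. -/
theorem exists_perm_apply_eq {n m : ℕ} (f : Fin m ↪ Fin n) :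
    ∃ p : Perm (Fin n), ∀ i, (p (f i) : ℕ) = i := by
  have hm : m ≤ n := by simpa using Fintype.card_le_of_embedding f
  obtain ⟨g, hg⟩ := Perm.exists_smul_eq_embedding f (Fin.castLEEmb hm)
  refine ⟨g, fun i => ?_⟩
  have := DFunLike.congr_fun hg i
  simpa using congrArg Fin.val this

theorem exists_perm_three {n : ℕ} {a b c : Fin n} (ab : a ≠ b) (ac : a ≠ c) (bc : b ≠ c) :
    3 ≤ n ∧ ∃ p : Perm (Fin n), (p a : ℕ) = 0 ∧ (p b : ℕ) = 1 ∧ (p c : ℕ) = 2 := by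
  have hf : Function.Injective ![a, b, c] := by
    intro i j
    fin_cases i <;> fin_cases j <;> simp_all [ab.symm, ac.symm, bc.symm]
  refine ⟨by simpa using Fintype.card_le_of_injective _ hf, ?_⟩
  obtain ⟨p, hp⟩ := exists_perm_apply_eq ⟨_, hf⟩
  exact ⟨p, hp 0, hp 1, hp 2⟩

theorem exists_perm_four {n : ℕ} {a b c d : Fin n} (ab : a ≠ b) (ac : a ≠ c) (ad : a ≠ d)
    (bc : b ≠ c) (bd : b ≠ d) (cd : c ≠ d) :
    4 ≤ n ∧ ∃ p : Perm (Fin n), (p a : ℕ) = 0 ∧ (p b : ℕ) = 1 ∧ (p c : ℕ) = 2 ∧ (p d : ℕ) = 3 := by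
  have hf : Function.Injective ![a, b, c, d] := by
    intro i j
    fin_cases i <;> fin_cases j <;> simp_all [ab.symm, ac.symm, ad.symm, bc.symm, bd.symm, cd.symm]
  refine ⟨by simpa using Fintype.card_le_of_injective _ hf, ?_⟩
  obtain ⟨p, hp⟩ := exists_perm_apply_eq ⟨_, hf⟩
  exact ⟨p, hp 0, hp 1, hp 2, hp 3⟩

theorem CyclicFamily.not_equivalent_zero {n : ℕ} {x y : Word n} (h : CyclicFamily x y) :
    ¬ Equivalent (x : WithZero (Word n)) 0 := by
  rw [not_equivalent_zero_iff]
  have inj : ∀ (p : Perm (Fin n)) (e f : Fin n), (p e : ℕ) = p f → e = f :=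
    fun p e f H => p.injective (Fin.ext H)
  cases h with
  | @outer a b c d ab ac bc ad bd h hd =>
    simp only [ops_word, Run, and_true, op]
    rcases hd with rfl | hd
    · obtain ⟨hn, p, pa, pc, pb⟩ := exists_perm_three ac ab bc.symm
      -- The letters start in the order `a | d, b`, with the cut marked and `d` in the role of `c`;
      -- all others stand further right and never block.
      refine ⟨⟨0, by omega⟩, p, ?_⟩
      rw [mul_assoc, Moves, moves_mul_swap_iff, moves_mul_swap_iff]
      simp only [Perm.mul_apply, swap_apply_left, swap_apply_right, swap_apply_of_ne_of_ne, ne_eq,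
        not_false_eq_true, ac.symm, bc.symm, Fin.lt_def, pa, pb, pc]
      refine ⟨⟨le_rfl, by omega, fun e h1 h2 => ?_⟩, ⟨le_rfl, by omega, fun e h1 h2 => ?_⟩,
        le_rfl, by omega, fun e h1 h2 => ?_⟩
      · rw [inj p e d (by omega)]
        unfold Cyc at *
        omega
      · omega
      · omega
    · have cd : c ≠ d := fun e => hd.ne_left (congrArg Fin.val e)
      -- The order `d, a | c, b` meets the requirement that `c` stand before `b`.
      obtain ⟨hn, p, pd, pa, pc, pb⟩ := exists_perm_four ad.symm cd.symm bd.symm ac ab bc.symm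
      refine ⟨⟨1, by omega⟩, p, ?_⟩
      rw [mul_assoc, Moves, moves_mul_swap_iff, moves_mul_swap_iff]
      simp only [Perm.mul_apply, swap_apply_left, swap_apply_right, swap_apply_of_ne_of_ne, ne_eq,
        not_false_eq_true, ac.symm, bc.symm, ad.symm, bd.symm,
        cd.symm, Fin.lt_def, pa, pb, pc, pd]
      refine ⟨⟨le_rfl, by omega, fun e h1 h2 => ?_⟩, ⟨le_rfl, by omega, fun e h1 h2 => ?_⟩,
        by omega, by omega, fun e h1 h2 => ?_⟩
      · rw [inj p e c (by omega)]
        unfold Cyc at *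
        omega
      · omega
      · rw [inj p e a (by omega), ← Perm.inv_def, mul_inv_rev, swap_inv, swap_inv, Perm.mul_apply,
          swap_apply_left, swap_apply_left]
        unfold Cyc at *
        omega
  | @inner a b c d bc bd cd ac ad h hd =>
    simp only [ops_word, Run, and_true, op]
    rcases hd with rfl | hd
    · obtain ⟨hn, p, pc, pb, pd⟩ := exists_perm_three bc.symm cd bd
      refine ⟨⟨1, by omega⟩, p, ?_⟩
      rw [mul_assoc, Moves, moves_mul_swap_iff, moves_mul_swap_iff]
      simp only [Perm.mul_apply, swap_apply_left, swap_apply_right, swap_apply_of_ne_of_ne, ne_eq,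
        not_false_eq_true, bd, bc, Fin.lt_def, pc, pb, pd]
      refine ⟨⟨by omega, by omega, fun e h1 h2 => ?_⟩, ⟨by omega, by omega, fun e h1 h2 => ?_⟩,
        by omega, by omega, fun e h1 h2 => ?_⟩
      · rw [inj p e a (by omega)]
        unfold Cyc at *
        omega
      · omega
      · omega
    · have hab : a ≠ b := fun e => hd.ne_right (congrArg Fin.val e)
      -- The order `c, b | a, d`.
      obtain ⟨hn, p, pc, pb, pa, pd⟩ := exists_perm_four bc.symm ac.symm cd hab.symm bd ad
      refine ⟨⟨1, by omega⟩, p, ?_⟩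
      rw [mul_assoc, Moves, moves_mul_swap_iff, moves_mul_swap_iff]
      simp only [Perm.mul_apply, swap_apply_left, swap_apply_right, swap_apply_of_ne_of_ne, ne_eq,
        not_false_eq_true, hab, ac, bc, ad, bd,
        Fin.lt_def, pa, pb, pc, pd]
      refine ⟨⟨by omega, by omega, fun e h1 h2 => ?_⟩, ⟨by omega, by omega, fun e h1 h2 => ?_⟩,
        by omega, by omega, fun e h1 h2 => ?_⟩
      · have : e = a ∨ e = b := by
          rcases (by omega : (p e : ℕ) = 2 ∨ (p e : ℕ) = 1) with H | H
          · exact .inl (inj p e a (by omega))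
          · exact .inr (inj p e b (by omega))
        unfold Cyc at *
        omega
      · rw [inj p e a (by omega)]
        simp only [symm_swap, swap_apply_of_ne_of_ne, ne_eq, not_false_eq_true, ac, ad]
        unfold Cyc at *
        omega
      · omega

/-! ### Rigidity of the families and grading by length -/

/-- This is what minimality rests on: no commutation applies to either side, and passing to the
other side changes both the first and the last operator. -/
theorem CyclicFamily.ne {n : ℕ} {o₁ o₂ o₃ o₁' o₂' o₃' : Op n}
    (h : CyclicFamily (word o₁ o₂ o₃) (word o₁' o₂' o₃')) :
    o₁ ≠ o₁' ∧ o₃ ≠ o₃' ∧ disjointOps (code o₁) (code o₂) = false ∧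
      disjointOps (code o₂) (code o₃) = false ∧ disjointOps (code o₁') (code o₂') = false ∧
      disjointOps (code o₂') (code o₃') = false := by
  generalize hx : word o₁ o₂ o₃ = x at h
  generalize hy : word o₁' o₂' o₃' = y at h
  have hx := congrArg ops hx
  have hy := congrArg ops hy
  cases h <;>
  · simp only [ops_word, List.cons.injEq, and_true] at hx hy
    obtain ⟨rfl, rfl, rfl⟩ := hx
    obtain ⟨rfl, rfl, rfl⟩ := hy
    simp only [Bool.eq_false_iff, ne_eq, disjointOps_iff, op, code, Subtype.mk.injEq, Prod.mk.injEq]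
    tauto

theorem qLength_of_opAct {n : ℕ} {k : Fin (n - 1)} {o : Op n} {x y : SnQ n}
    (h : opAct k o x = some y) : qLength y = qLength x + 1 := by
  simp only [opAct] at h
  split_ifs at h with h1 h2
  · obtain ⟨-, i, j, -, -, -, hl⟩ := h1
    rw [← Option.some_inj.1 h, hl]
  · obtain ⟨-, -, i, j, -, -, -, hl⟩ := h2
    rw [← Option.some_inj.1 h, hl]

theorem qLength_of_wordAct {n : ℕ} {k : Fin (n - 1)} {w : Word n} {x y : SnQ n}
    (h : wordAct k w (some x) = some y) : qLength y = qLength x + w.length := by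
  induction w using FreeMonoid.recOn generalizing y with
  | one =>
    rw [map_one] at h
    have : x = y := Option.some_inj.1 h
    simp [this]
  | of_mul o w ih =>
    rw [map_mul] at h
    change (wordAct k w (some x)).bind (opAct k o) = some y at h
    obtain ⟨z, hz, hy⟩ := Option.bind_eq_some_iff.1 h
    rw [qLength_of_opAct hy, ih hz, FreeMonoid.length_mul, FreeMonoid.length_of]
    ring

theorem Equivalent.symm {n : ℕ} {x y : WithZero (Word n)} (h : Equivalent x y) : Equivalent y x :=
  fun k u => (h k u).symm

theorem Equivalent.trans {n : ℕ} {x y z : WithZero (Word n)} (h : Equivalent x y)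
    (h' : Equivalent y z) : Equivalent x z :=
  fun k u => (h k u).trans (h' k u)

/-- Each operator raises `qLength` by one, so a single non-zero value determines the number of
operators. -/
theorem Equivalent.length_eq {n : ℕ} {w w' : Word n}
    (h : Equivalent (w : WithZero (Word n)) w') (h0 : ¬ Equivalent (w : WithZero (Word n)) 0) :
    w.length = w'.length := by
  simp only [Equivalent, not_forall] at h0
  obtain ⟨k, u, hu⟩ := h0
  obtain ⟨y, hy⟩ := Option.ne_none_iff_exists'.1 hu
  have h1 := qLength_of_wordAct (w := w) hy
  have h2 := qLength_of_wordAct (w := w') ((h k u).symm.trans hy)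
  omega

theorem act_mul {n : ℕ} (k : Fin (n - 1)) (x y : WithZero (Word n)) (z : Option (SnQ n)) :
    act k (x * y) z = act k x (act k y z) := by
  induction x with
  | zero => rw [zero_mul]; rfl
  | coe x =>
    induction y with
    | zero => rw [mul_zero]; exact (wordAct_none k x).symm
    | coe y =>
      change wordAct k (x * y) z = wordAct k x (wordAct k y z)
      rw [map_mul]
      rfl

theorem act_none {n : ℕ} (k : Fin (n - 1)) (x : WithZero (Word n)) : act k x none = none := by
  induction x with
  | zero => rfl
  | coe x => exact wordAct_none k x

theorem Equivalent.mul_mul {n : ℕ} {x y : WithZero (Word n)} (h : Equivalent x y)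
    (s t : WithZero (Word n)) : Equivalent (s * x * t) (s * y * t) := by
  intro k u
  simp only [act_mul]
  rcases act k t (some u) with _ | z
  · rw [act_none k x, act_none k y]
  · rw [h k z]

theorem CyclicFamily.length {n : ℕ} {x y : Word n} (h : CyclicFamily x y) :
    x.length = 3 ∧ y.length = 3 := by
  cases h <;> simp [← length_ops, ops_word]

/-- A nonzero equivalence between compositions of three operators is a rearrangement or belongs to
one of the families. -/
theorem rearranged_or_cyclicFamily {n : ℕ} {o₁ o₂ o₃ o₁' o₂' o₃' : Op n}
    (h : Equivalent (word o₁ o₂ o₃ : WithZero (Word n)) (word o₁' o₂' o₃'))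
    (h0 : ¬ Equivalent (word o₁ o₂ o₃ : WithZero (Word n)) 0) :
    rearranged (triple o₁ o₂ o₃) (triple o₁' o₂' o₃') = true ∨
      CyclicFamily (word o₁ o₂ o₃) (word o₁' o₂' o₃') ∨
      CyclicFamily (word o₁' o₂' o₃') (word o₁ o₂ o₃) := by
  have := related_of_equivalent h h0
  simp only [related, Bool.or_eq_true] at this
  rcases this with (((h | h) | h) | h) | h
  · exact .inl h
  · exact .inr (.inl (.of_outerFamily h))
  · exact .inr (.inr (.of_outerFamily h))
  · exact .inr (.inl (.of_innerFamily h))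
  · exact .inr (.inr (.of_innerFamily h))

/-! ### Minimality -/

/-- A member of one of the families is the only composition equivalent to it that shares its first
or its last operator. -/
theorem eq_of_equivalent {n : ℕ} {x y z : Word n} (h : CyclicFamily x y ∨ CyclicFamily y x)
    (h0 : ¬ Equivalent (x : WithZero (Word n)) 0) (he : Equivalent (x : WithZero (Word n)) z)
    (hs : (ops x).head? = (ops z).head? ∨ (ops x).getLast? = (ops z).getLast?) : z = x := by
  have hl : x.length = 3 ∧ y.length = 3 := by
    rcases h with h | h
    · exact h.length
    · exact h.length.symm
  obtain ⟨o₁, o₂, o₃, rfl⟩ := exists_eq_word hl.1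
  obtain ⟨p₁, p₂, p₃, rfl⟩ := exists_eq_word hl.2
  obtain ⟨o₁', o₂', o₃', rfl⟩ := exists_eq_word ((he.length_eq h0).symm.trans hl.1)
  simp only [ops_word, List.head?_cons, List.getLast?_cons_cons, List.getLast?_singleton,
    Option.some_inj] at hs
  have hd : disjointOps (code o₁) (code o₂) = false ∧ disjointOps (code o₂) (code o₃) = false := by
    rcases h with h | h
    · exact ⟨h.ne.2.2.1, h.ne.2.2.2.1⟩
    · exact h.ne.2.2.2.2
  rcases rearranged_or_cyclicFamily he h0 with h | h | h
  -- Neighbouring operators share a letter, so the only rearrangement is the trivial one.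
  · simp only [rearranged, triple, hd.1, hd.2, Bool.false_and, Bool.or_false] at h
    exact sameTriple_triple h
  · exact absurd hs (not_or.2 ⟨h.ne.1, h.ne.2.1⟩)
  · exact absurd hs (not_or.2 ⟨h.ne.1.symm, h.ne.2.1.symm⟩)

/-- The syntactic congruence of an element of a monoid. -/
def syntacticCon {M : Type*} [Monoid M] (x : M) : Con M where
  r p q := ∀ s t, s * p * t = x ↔ s * q * t = x
  iseqv := ⟨fun _ _ _ => Iff.rfl, fun h s t => (h s t).symm, fun h h' s t => (h s t).trans (h' s t)⟩
  mul' := by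
    intro p q p' q' h h' s t
    have h1 := h s (p' * t)
    have h2 := h' (s * q) t
    simp only [mul_assoc] at h1 h2 ⊢
    exact h1.trans h2

/-- If `x = s * p * t` and `p ≡ q` has degree below three, then `s` or `t` is not empty, so `s * q *
t` is equivalent to `x` and shares an end operator with it, hence equals `x`. Thus every generator
lies in the syntactic congruence, for which `x` is alone in its class. -/
theorem lowerCon_le_syntacticCon {n : ℕ} {x y : Word n} (h : CyclicFamily x y ∨ CyclicFamily y x)
    (h0 : ¬ Equivalent (x : WithZero (Word n)) 0) :
    lowerCon n 3 ≤ syntacticCon (x : WithZero (Word n)) := by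
  have key : ∀ p q s t : WithZero (Word n), Equivalent p q → equivDegree p q < 3 →
      s * p * t = x → s * q * t = x := by
    intro p q s t he hdeg hx
    have he' : Equivalent (x : WithZero (Word n)) (s * q * t) := hx ▸ he.mul_mul s t
    induction s with
    | zero => simp at hx
    | coe s =>
    induction t with
    | zero => simp at hx
    | coe t =>
    induction p with
    | zero => simp at hx
    | coe p =>
    induction q with
    | zero => exact absurd (by simpa using he') h0
    | coe q =>
    rw [← WithZero.coe_mul, ← WithZero.coe_mul] at he' hx ⊢
    rw [WithZero.coe_inj] at hx ⊢
    have hp : p.length < 3 := lt_of_le_of_lt (le_max_left _ _) hdeg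
    have hl : x.length = 3 := by
      rcases h with h | h
      · exact h.length.1
      · exact h.length.2
    refine eq_of_equivalent h h0 he' ?_
    rw [← hx, ops_mul, ops_mul, ops_mul, ops_mul]
    -- A non-empty `t` preserves the operator acting first; otherwise `s` is non-empty, since `p`
    -- has fewer than three operators, and preserves the one acting last.
    rcases ht : ops t with _ | ⟨o, l⟩
    · right
      have hs : ops s ≠ [] := by
        intro hs
        rw [← length_ops, ← hx, ops_mul, ops_mul, ht, hs, List.nil_append, List.append_nil,
          length_ops] at hl
        omega
      rw [List.nil_append, List.nil_append, List.getLast?_append_of_ne_nil _ hs,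
        List.getLast?_append_of_ne_nil _ hs]
    · left
      rfl
  refine Con.conGen_le.2 fun p q hpq s t => ⟨key p q s t hpq.1 hpq.2, key q p s t hpq.1.symm ?_⟩
  rw [equivDegree, max_comm]
  exact hpq.2

theorem CyclicFamily.not_lowerCon {n : ℕ} {x y : Word n} (h : CyclicFamily x y) :
    ¬ lowerCon n 3 (x : WithZero (Word n)) y := by
  intro hc
  have := (lowerCon_le_syntacticCon (.inl h) h.not_equivalent_zero hc 1 1).1 (by simp)
  rw [one_mul, mul_one, WithZero.coe_inj] at this
  obtain ⟨o₁, o₂, o₃, rfl⟩ := exists_eq_word h.length.1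
  subst this
  exact h.ne.1 rfl

theorem CyclicFamily.equivDegree_eq {n : ℕ} {x y : Word n} (h : CyclicFamily x y) :
    equivDegree (x : WithZero (Word n)) y = 3 := by
  change max x.length y.length = 3
  rw [h.length.1, h.length.2, max_self]

theorem CyclicFamily.isMinimalEquiv {n : ℕ} {x y : Word n} (h : CyclicFamily x y) :
    IsMinimalEquiv (x : WithZero (Word n)) y :=
  ⟨h.equivalent, h.equivDegree_eq.symm ▸ h.not_lowerCon⟩

theorem IsMinimalEquiv.symm {n : ℕ} {x y : WithZero (Word n)} (h : IsMinimalEquiv x y) :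
    IsMinimalEquiv y x :=
  ⟨h.1.symm, fun hc => h.2 ((lowerCon n _).symm (by rwa [equivDegree, max_comm] at hc))⟩

theorem cyclicFamily_of_isMinimalEquiv {n : ℕ} {x y : Word n}
    (h0 : ¬ Equivalent (x : WithZero (Word n)) 0) (hd : equivDegree (x : WithZero (Word n)) y = 3)
    (h : IsMinimalEquiv (x : WithZero (Word n)) y) : CyclicFamily x y ∨ CyclicFamily y x := by
  have hl := h.1.length_eq h0
  have hx : max x.length y.length = 3 := hd
  obtain ⟨o₁, o₂, o₃, rfl⟩ := exists_eq_word (show x.length = 3 by omega)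
  obtain ⟨o₁', o₂', o₃', rfl⟩ := exists_eq_word (show y.length = 3 by omega)
  refine (rearranged_or_cyclicFamily h.1 h0).resolve_left fun hr => h.2 ?_
  rw [hd]
  exact lowerCon_of_rearranged hr

end QuantumBruhat

theorem mainTheorem2 (n : ℕ) (x y : QuantumBruhat.Word n) :
    (¬ QuantumBruhat.Equivalent (x : WithZero (QuantumBruhat.Word n)) 0 ∧
      QuantumBruhat.equivDegree (x : WithZero (QuantumBruhat.Word n)) y = 3 ∧
      QuantumBruhat.IsMinimalEquiv (x : WithZero (QuantumBruhat.Word n)) y) ↔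
    (QuantumBruhat.Listed x y ∨ QuantumBruhat.Listed y x) := by
  constructor
  · rintro ⟨h0, hd, h⟩
    exact (QuantumBruhat.cyclicFamily_of_isMinimalEquiv h0 hd h).imp (·.listed) (·.listed)
  · rintro (h | h)
    · have h := QuantumBruhat.CyclicFamily.of_listed h
      exact ⟨h.not_equivalent_zero, h.equivDegree_eq, h.isMinimalEquiv⟩
    · have h := QuantumBruhat.CyclicFamily.of_listed h
      refine ⟨fun h' => h.not_equivalent_zero (h.equivalent.trans h'), ?_, h.isMinimalEquiv.symm⟩
      rw [QuantumBruhat.equivDegree, max_comm]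
      exact h.equivDegree_eq
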